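/- **Notions.** Addresses are finite sequences of natural numbers. An action is either the daimon $\maltese$ (which is positive) or a proper action $(\pm,\xi,I)$ with polarity $\pm$, focus an address $\xi$, and ramification a finite set $I$ of integers; it *justifies* the actions $(\mp,\xi.k,J)$ with $k\in I$. A simple base is $\vdash\xi$ (dual base $\xi\vdash$) or $\xi\vdash$ (dual base $\vdash\xi$); an action is *initial* if it has focus $\xi$ and is positive (base $\vdash\xi$), resp. negative (base $\xi\vdash$). A *path* on such a base is a finite sequence of actions with alternating polarities such that: every proper action is initial or justified by an earlier one; if a positive $\kappa$ is justified by $\kappa'$, there are $\alpha_0^+=\kappa,\alpha_0^-,\dots,\alpha_n^+,\alpha_n^-=\kappa'$ in the sequence with $\alpha_i^-$ immediately preceding $\alpha_i^+$ and $\alpha_{i}^-$ justified by $\alpha_{i+1}^+$; focuses are pairwise distinct; $\maltese$ occurs only as last action, and as first action only on $\vdash\xi$; on $\vdash\xi$ the sequence is non-empty and starts with $\maltese$ or an initial action. A *chronicle* is a non-empty path in which every non-initial negative action is justified by the action immediately before it. Two chronicles are *coherent* if they are comparable for the prefix order or first differ on negative actions and, when these have distinct focuses, no focus occurs after them in both chronicles.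 A *design* is a prefix-closed set of pairwise coherent chronicles whose maximal elements end with a positive action, non-empty if the base is $\vdash\xi$. Designs on dual bases interact by cut elimination: at each step, let $\kappa$ be the first action of the only design of positive base in the current net. If $\kappa=\maltese$, the interaction ends successfully. If $\kappa=(+,\sigma,I)$, then the design of the opposite side with focus $\sigma$ must contain the first action $(-,\sigma,I)$ (otherwise the interaction fails), and one continues after replacing both designs by their subdesigns above these two actions. The two designs are *orthogonal* if the interaction ends successfully after finitely many steps; $\langle D\leftarrow E\rangle$ denotes the sequence of actions then visited in $D$. For a set $\mathbf A$ of designs on a base, $\mathbf A^\perp$ is the set of designs on the dual base orthogonal to all elements of $\mathbf A$, and $\mathbf A$ is a *behaviour* if $\mathbf A=\mathbf A^{\perp\perp}$. The set of *visitable* paths is $V_{\mathbf A}=\{\langle D\leftarrow E\rangle : D\in\mathbf A, E\in\mathbf A^\perp\}$. A design is *material* in $\mathbf A$ if it is minimal in $\mathbf A$ for inclusion. A sequence is *positive-ended* if it is empty or its last action is positive. The *dual* of a positive-ended sequence reverses all polarities and removes the final $\maltese$ if there is one, and adds a final $\maltese$ otherwise. A path is *reversible* if it is positive-ended and its dual is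 a positive-ended path on the dual base. A reversible path $p$ on the base of $\mathbf A$ is *regular for* $\mathbf A$ if for each proper action $\kappa$ of $p$ the subsequence of $p$ made of $\kappa$, its justifier, the justifier of its justifier, and so on up to an initial action, is also the sequence obtained in this way from a proper action of a chronicle of a material design of $\mathbf A$. The *shuffle* of two paths $sa$, $sb$, where $s$ is positive-ended and each of $a,b$ is empty or starts with a negative action and ends with a positive one, and no focus occurs in both $a$ and $b$, is, when $a,b$ do not both end with $\maltese$, the set of sequences $s\,a_1b_1\cdots a_nb_n$ with $a=a_1\cdots a_n$, $b=b_1\cdots b_n$, where each $a_i,b_i$ is empty or starts with a negative and ends with a positive action, and $\maltese$ occurs only at the end. For $a=a'\kappa_1\maltese$, $b=b'\kappa_2\maltese$ it is the union of the shuffle of $sa$ and $sb'$ and the shuffle of $sa'$ and $sb$ (here it suffices that these two shuffles are defined separately). **Proposition.** Let $\mathbf A$ be a behaviour of simple base, i.e. of base $\vdash\xi$ or $\xi\vdash$. The following are equivalent. 1. $\mathbf A$ is *regular*: every path that is regular for $\mathbf A$ is visitable in $\mathbf A$. 2. $\mathbf A$ is *shuffle-regular*: every positive-ended chronicle of a material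 design of $\mathbf A$ (resp. of $\mathbf A^\perp$) is visitable in $\mathbf A$ (resp. in $\mathbf A^\perp$), and $V_{\mathbf A}$ and $V_{\mathbf A^\perp}$ are stable under reversible shuffle: every reversible path that belongs to the shuffle of two elements of $V_{\mathbf A}$ (resp. $V_{\mathbf A^\perp}$) belongs to $V_{\mathbf A}$ (resp. $V_{\mathbf A^\perp}$). -/

import Mathlib

namespace Ludics

/-! ### Addresses, actions, simple bases -/

/-- An address (locus) is a finite sequence of natural numbers; `ξ.k` is `ξ ++ [k]`. -/
abbrev Address : Type := List ℕ

inductive Polarity : Type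
  | plus : Polarity
  | minus : Polarity

/-- Exchange of the two polarities. -/
def Polarity.opp : Polarity → Polarity
  | .plus => .minus
  | .minus => .plus

/-- An action is a proper action (polarity, focus, ramification), or the daimon. -/
inductive Action : Type
  | proper (ε : Polarity) (ξ : Address) (I : Finset ℕ) : Action
  | daimon : Action

/-- The daimon is a positive action. -/
def Action.polarity : Action → Polarity
  | .proper ε _ _ => ε
  | .daimon => .plus

/-- The focus of a proper action; the daimon has no focus. -/
def Action.focus : Action → Option Address
  | .proper _ ξ _ => some ξ
  | .daimon => none

/-- Reversal of the polarity of a proper action. -/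
def Action.bar : Action → Action
  | .proper ε ξ I => .proper ε.opp ξ I
  | .daimon => .daimon

/-- `Justifies κ' κ`: the focus of `κ` is one of the addresses created by `κ'`; the two actions have
opposite polarities. -/
def Justifies : Action → Action → Prop
  | .proper ε ξ I, .proper ε' ξ' _ => ε' = ε.opp ∧ ∃ k ∈ I, ξ' = ξ ++ [k]
  | _, _ => False

/-- A simple base: `⟨plus, ξ⟩` stands for `⊢ ξ`, and `⟨minus, ξ⟩` stands for `ξ ⊢`. -/
structure Base : Type where
  polarity : Polarity
  addr : Address

/-- The dual base: `⊢ ξ` and `ξ ⊢` are exchanged. -/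
def Base.dual (β : Base) : Base := ⟨β.polarity.opp, β.addr⟩

/-- Initial actions on `⊢ ξ` (resp. `ξ ⊢`): the positive (resp. negative) actions of focus `ξ`. -/
def Initial (β : Base) (κ : Action) : Prop :=
  κ.focus = some β.addr ∧ κ.polarity = β.polarity

/-! ### Paths and chronicles -/

/-- The list of focuses of a sequence of actions. -/
def focuses (p : List Action) : List Address := p.filterMap Action.focus

/-- The last action, if there is one, is positive (the empty sequence is positive-ended). -/
def PositiveEnded (p : List Action) : Prop := ∀ κ ∈ p.getLast?, κ.polarity = .plus

/-- `NegJump p κ' κ`: there are `α₀⁺ = κ, α₀⁻, …, αₙ⁺, αₙ⁻ = κ'` in `p` such that each `αᵢ⁺` is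
immediately preceded in `p` by `αᵢ⁻`, and each `αᵢ⁻` (`i < n`) is justified by `αᵢ₊₁⁺`. -/
inductive NegJump (p : List Action) (κ' : Action) : Action → Prop
  | direct {κ : Action} : [κ', κ] <:+: p → NegJump p κ' κ
  | step {κ α γ : Action} : [α, κ] <:+: p → γ ∈ p → Justifies γ α → NegJump p κ' γ →
      NegJump p κ' κ

/-- Paths on a simple base. (On a simple base the part of the negative jump condition that concerns
initial positive actions is contained in totality and linearity: such an action is the first.) -/
structure IsPath (β : Base) (p : List Action) : Prop where
  alternation : p.IsChain (fun κ κ' => κ.polarity ≠ κ'.polarity)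
  justification : ∀ w κ, w ++ [κ] <+: p → κ ≠ .daimon → Initial β κ ∨ ∃ κ' ∈ w, Justifies κ' κ
  negativeJump : ∀ κ ∈ p, ∀ κ' ∈ p, κ.polarity = .plus → Justifies κ' κ → NegJump p κ' κ
  linearity : (focuses p).Nodup
  daimon_last : Action.daimon ∉ p.dropLast
  daimon_first : p.head? = some .daimon → β.polarity = .plus
  totality : β.polarity = .plus → ∃ κ, p.head? = some κ ∧ (κ = .daimon ∨ Initial β κ)

/-- Chronicles: non-empty paths in which each non-initial negative action is justified by the
immediately preceding action. -/
structure IsChronicle (β : Base) (c : List Action) : Prop where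
  isPath : IsPath β c
  ne_nil : c ≠ []
  negative_justified : ∀ w κ, w ++ [κ] <+: c → κ.polarity = .minus → ¬ Initial β κ →
    ∃ κ', w.getLast? = some κ' ∧ Justifies κ' κ

/-! ### Designs -/

/-- Coherence of two chronicles: comparability and propagation. -/
structure Coherent (c₁ c₂ : List Action) : Prop where
  comparability : ∀ w κ₁ κ₂, w ++ [κ₁] <+: c₁ → w ++ [κ₂] <+: c₂ →
    κ₁ = κ₂ ∨ (κ₁.polarity = .minus ∧ κ₂.polarity = .minus)
  propagation : ∀ w ξ₁ I₁ u₁ ξ₂ I₂ u₂, c₁ = w ++ .proper .minus ξ₁ I₁ :: u₁ →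
    c₂ = w ++ .proper .minus ξ₂ I₂ :: u₂ → ξ₁ ≠ ξ₂ → (focuses u₁).Disjoint (focuses u₂)

/-- Designs on a simple base, presented as cliques of chronicles. -/
structure IsDesign (β : Base) (D : Set (List Action)) : Prop where
  chronicle : ∀ c ∈ D, IsChronicle β c
  clique : ∀ c₁ ∈ D, ∀ c₂ ∈ D, Coherent c₁ c₂
  prefix_closed : ∀ c ∈ D, ∀ c', c' <+: c → c' ≠ [] → c' ∈ D
  maximal_positive : ∀ c ∈ D, (∀ d ∈ D, c <+: d → d = c) → PositiveEnded c
  nonempty : β.polarity = .plus → D.Nonempty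

/-! ### Interaction, orthogonality, behaviours -/

/-- A net of designs is identified with the set of the chronicles of its designs. `residual R κ` is
the net that remains when the design of `R` with first action `κ` is replaced by its subdesigns
above `κ`: the chronicles that start with another action on the focus of `κ` are erased, the other
designs of the net are kept. (Parts of the net that get disconnected from the main design are not
erased; they are never used later.) -/
def residual (R : Set (List Action)) (κ : Action) : Set (List Action) :=
  {c | c ≠ [] ∧ κ :: c ∈ R} ∪ {c | c ∈ R ∧ ∀ κ' ∈ c.head?, κ'.focus ≠ κ.focus}

/-- `Interact S T p`: the interaction of the closed cut-net formed of the nets `S` and `T` converges,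
i.e. ends with the daimon after finitely many steps, and `p` is the sequence of actions visited in
`S`. At each step, the first action of the main design is a daimon (in `S` or in `T`) and the
interaction stops, or it is a proper positive action of `S` (resp. of `T`) and the dual action
is present in `T` (resp. in `S`); there is no derivation if the interaction fails or is infinite. -/
inductive Interact : Set (List Action) → Set (List Action) → List Action → Prop
  | daimon_left {S T : Set (List Action)} : [Action.daimon] ∈ S → Interact S T [.daimon]
  | daimon_right {S T : Set (List Action)} : [Action.daimon] ∈ T → Interact S T []
  | left {S T : Set (List Action)} {σ : Address} {I : Finset ℕ} {p : List Action} :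
      [Action.proper .plus σ I] ∈ S → [Action.proper .minus σ I] ∈ T →
      Interact (residual S (.proper .plus σ I)) (residual T (.proper .minus σ I)) p →
      Interact S T (.proper .plus σ I :: p)
  | right {S T : Set (List Action)} {σ : Address} {I : Finset ℕ} {p : List Action} :
      [Action.proper .minus σ I] ∈ S → [Action.proper .plus σ I] ∈ T →
      Interact (residual S (.proper .minus σ I)) (residual T (.proper .plus σ I)) p →
      Interact S T (.proper .minus σ I :: p)

/-- Orthogonality of two designs on dual simple bases: their interaction converges. -/
def Orthogonal (D E : Set (List Action)) : Prop := ∃ p, Interact D E p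

/-- The orthogonal of a set `A` of designs of base `β`. -/
def orth (β : Base) (A : Set (Set (List Action))) : Set (Set (List Action)) :=
  {E | IsDesign β.dual E ∧ ∀ D ∈ A, Orthogonal D E}

/-- `A` is a behaviour of base `β`: a set of designs of base `β` equal to its bi-orthogonal. -/
def IsBehaviour (β : Base) (A : Set (Set (List Action))) : Prop :=
  (∀ D ∈ A, IsDesign β D) ∧ A = orth β.dual (orth β A)

/-- Visitable paths of a behaviour. -/
def Visitable (β : Base) (A : Set (Set (List Action))) (p : List Action) : Prop :=
  ∃ D ∈ A, ∃ E ∈ orth β A, Interact D E p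

/-- Material designs: the minimal elements of the behaviour with respect to inclusion. -/
def Material (A : Set (Set (List Action))) (D : Set (List Action)) : Prop :=
  Minimal (fun D' => D' ∈ A) D

/-! ### Duality and reversible paths -/

open Classical in
/-- The dual of a positive-ended alternate sequence: `w✠` is sent to the opposite of `w`, and a `p`
that does not end with a daimon is sent to its opposite followed by a daimon. -/
noncomputable def dual (p : List Action) : List Action :=
  if p.getLast? = some .daimon then p.dropLast.map Action.bar
  else p.map Action.bar ++ [.daimon]

/-- `p` and its dual are positive-ended paths (on dual bases). -/
def Reversible (β : Base) (p : List Action) : Prop :=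
  IsPath β p ∧ PositiveEnded p ∧ IsPath β.dual (dual p) ∧ PositiveEnded (dual p)

/-! ### Regularity -/

/-- `t` is the subsequence of `p` formed of `κ`, its justifier, the justifier of its justifier, and
so on until an initial action. -/
def IsJustifierSequence (β : Base) (p : List Action) (κ : Action) (t : List Action) : Prop :=
  t.Sublist p ∧ t.getLast? = some κ ∧ t.IsChain Justifies ∧ ∃ κ₀, t.head? = some κ₀ ∧ Initial β κ₀

/-- Trivial chronicles for `A`: sequences of justifiers of the proper actions of the chronicles of
the material designs of `A`. -/
def IsTrivialChronicle (β : Base) (A : Set (Set (List Action))) (t : List Action) : Prop :=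
  ∃ D, Material A D ∧ ∃ c ∈ D, ∃ κ ∈ c, κ ≠ .daimon ∧ IsJustifierSequence β c κ t

/-- Paths that are regular for `A`. -/
def RegularPath (β : Base) (A : Set (Set (List Action))) (p : List Action) : Prop :=
  Reversible β p ∧ ∀ κ ∈ p, κ ≠ .daimon →
    ∃ t, IsJustifierSequence β p κ t ∧ IsTrivialChronicle β A t

/-- Regular behaviours. -/
def Regular (β : Base) (A : Set (Set (List Action))) : Prop :=
  ∀ p, RegularPath β A p → Visitable β A p

/-! ### Shuffle and shuffle-regularity -/

/-- A segment of an alternate sequence that is empty, or starts with a negative action and ends with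
a positive one. -/
def NegSegment (a : List Action) : Prop :=
  (∀ κ ∈ a.head?, κ.polarity = .minus) ∧ PositiveEnded a

/-- `t = a₁ b₁ … aₙ bₙ` is a shuffle of the positive-ended negative sequences `a = a₁ … aₙ` and
`b = b₁ … bₙ`, not both ended by a daimon; a daimon occurs in `t` only as the last action. For
segments `a`, `b` of paths with a common past, having disjoint bases means that no action of `a` has
the focus of an action of `b`. -/
def SegmentShuffle (a b t : List Action) : Prop :=
  NegSegment a ∧ NegSegment b ∧ (focuses a).Disjoint (focuses b) ∧
  ¬ (a.getLast? = some .daimon ∧ b.getLast? = some .daimon) ∧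
  ∃ L : List (List Action × List Action),
    (∀ x ∈ L, NegSegment x.1 ∧ NegSegment x.2) ∧
    (L.map Prod.fst).flatten = a ∧ (L.map Prod.snd).flatten = b ∧
    (L.map (fun x => x.1 ++ x.2)).flatten = t ∧ Action.daimon ∉ t.dropLast

/-- Extension to segments that both end with a daimon:
`a'κ₁✠ ⧢ b'κ₂✠ = (a'κ₁✠ ⧢ b') ∪ (a' ⧢ b'κ₂✠)`. -/
def SegmentShuffleExt (a b t : List Action) : Prop :=
  SegmentShuffle a b t ∨
  ∃ a' κ₁ b' κ₂, a = a' ++ [κ₁, .daimon] ∧ b = b' ++ [κ₂, .daimon] ∧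
    (SegmentShuffle a b' t ∨ SegmentShuffle a' b t)

/-- `Shuffle p q r`: `r` belongs to the shuffle of the paths `p` and `q`, that is, `p = sa`,
`q = sb` and `r = st` where `s` is positive-ended and `t` is a shuffle of `a` and `b`. -/
def Shuffle (p q r : List Action) : Prop :=
  ∃ s a b t, PositiveEnded s ∧ p = s ++ a ∧ q = s ++ b ∧ r = s ++ t ∧ SegmentShuffleExt a b t

/-- Stability of the visitable paths of `A` by reversible shuffle. -/
def StableByReversibleShuffle (β : Base) (A : Set (Set (List Action))) : Prop :=
  ∀ p q r, Visitable β A p → Visitable β A q → Shuffle p q r → Reversible β r → Visitable β A r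

/-- The positive-ended chronicles of the material designs of `A` are visitable in `A`. -/
def ChroniclesVisitable (β : Base) (A : Set (Set (List Action))) : Prop :=
  ∀ D, Material A D → ∀ c ∈ D, PositiveEnded c → Visitable β A c

/-- Shuffle-regular behaviours. -/
def ShuffleRegular (β : Base) (A : Set (Set (List Action))) : Prop :=
  ChroniclesVisitable β A ∧ ChroniclesVisitable β.dual (orth β A) ∧
  StableByReversibleShuffle β A ∧ StableByReversibleShuffle β.dual (orth β A)

end Ludics

namespace Ludics

open List

/-! ### Lists -/

section Lists

variable {α : Type*}

/-! Both conditions are compared on the proper actions of a path. Removing the daimon turns a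
reversible path into a `Play`, a notion stable under reversal of polarities; `close` restores the
daimon, so dualizing a path amounts to applying `bar` to its play. Each statement about `A` can then
be read in its orthogonal `B`.

The semantic input is that interaction is deterministic and local. Every action of a visited path
ends exactly one chronicle of the design extracted from the path before it (`IsDesign.view_unique`),
so the pair of designs determines the path (`Interact.unique`), and the interaction uses only the
chronicles extracted from it (`Interact.of_travels`). Consequently material designs consist of
visited chronicles (`DualPair.visitedPart_eq`), and the justifier sequences found in a visited path
are trivial chronicles (`DualPair.exists_trivialChronicle`).

Regular implies shuffle-regular: a shuffle preserves the order of its components, and justifier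
sequences are unique because focuses are distinct. So a reversible shuffle of visited paths is again
a regular path, as is a positive-ended chronicle of a material design of `A`; for `B` the same is
done on dual paths.

Conversely, argue by induction on the length of a play with trivial justifier sequences. If some
negative action is not justified by the action just before it, take the last such `κ`, with
justifier `γ`: the play is `s γ q κ r`, a shuffle of the shorter plays `s γ q` and `s γ κ r`
(`Play.exists_shuffle`). If a positive action is at fault, do this on the dual side. If none is,
each action is justified by its predecessor and the play is itself a trivial chronicle. Such a
chronicle is visitable (`DualPair.visited_trivialChronicle`): a chronicle of `A` containing it is
visitable, the dual path extracts from a material design of `B` exactly the reversed justifier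
sequence, and visitability of that chronicle of `B` dualizes back. -/

theorem eq_nil_or_append_singleton (l : List α) : l = [] ∨ ∃ l' a, l = l' ++ [a] := by
  rcases List.eq_nil_or_concat l with h | ⟨l', a, h⟩
  · exact .inl h
  · exact .inr ⟨l', a, by simpa using h⟩

theorem append_cons_inj_of_nodup {l r l' r' : List α} {a : α} (h : (l ++ a :: r).Nodup)
    (e : l ++ a :: r = l' ++ a :: r') : l = l' ∧ r = r' := by
  have h1 : a ∉ l ∧ a ∉ r := by
    rw [List.nodup_append, List.nodup_cons] at h
    exact ⟨fun ha => h.2.2 a ha a (by simp) rfl, h.2.1.1⟩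
  have := (List.append_cons_inj_of_notMem h1.1 h1.2).1 e
  exact ⟨this.1, this.2.2⟩

/-- The final `a` can be matched no later than the displayed occurrence, so what precedes it fits in
`l`. -/
theorem sublist_of_append_singleton_sublist {u l r : List α} {a : α} (ha : a ∉ r)
    (h : u ++ [a] <+ l ++ a :: r) : u <+ l := by
  rw [List.sublist_append_iff] at h
  obtain ⟨l₁, l₂, e, h₁, h₂⟩ := h
  rcases eq_nil_or_append_singleton l₂ with rfl | ⟨m, b, rfl⟩
  · rw [List.append_nil] at e
    subst e
    exact (List.sublist_append_left u [a]).trans h₁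
  · rw [← List.append_assoc] at e
    obtain ⟨rfl, hb⟩ := List.append_inj' e rfl
    simp only [List.cons.injEq, and_true] at hb
    subst hb
    rcases eq_nil_or_append_singleton m with rfl | ⟨m', b, rfl⟩
    · simpa using h₁
    · exfalso
      have : [a] <+ r := by
        have h3 : ([b] ++ [a]) <+ a :: r :=
          ((List.sublist_append_right m' [b]).append (List.Sublist.refl [a])).trans h₂
        rcases h3 with _ | h3 | h3
        · rename_i h3
          exact (List.sublist_append_right [b] [a]).trans h3
        · assumption
      exact ha (this.subset (by simp))

theorem exists_prefix_of_append_singleton_sublist {u w : List α} {a : α} (h : u ++ [a] <+ w) :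
    ∃ l r, w = l ++ a :: r ∧ u <+ l := by
  rw [List.append_sublist_iff] at h
  obtain ⟨r₁, r₂, rfl, h₁, h₂⟩ := h
  obtain ⟨s, t, rfl⟩ := List.mem_iff_append.1 (h₂.subset (by simp : a ∈ [a]))
  exact ⟨r₁ ++ s, t, by simp, h₁.trans (List.sublist_append_left _ _)⟩

end Lists

/-! ### Polarities, bases, actions -/

@[simp] theorem Polarity.opp_opp (ε : Polarity) : ε.opp.opp = ε := by cases ε <;> rfl

theorem Polarity.opp_inj {ε ε' : Polarity} : ε.opp = ε'.opp ↔ ε = ε' := by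
  cases ε <;> cases ε' <;> simp [Polarity.opp]

theorem Polarity.ne_iff {ε ε' : Polarity} : ε ≠ ε' ↔ ε' = ε.opp := by
  cases ε <;> cases ε' <;> simp [Polarity.opp]

@[simp] theorem Polarity.ne_plus {ε : Polarity} : ¬ ε = .plus ↔ ε = .minus := by cases ε <;> simp

@[simp] theorem Polarity.ne_minus {ε : Polarity} : ¬ ε = .minus ↔ ε = .plus := by cases ε <;> simp

@[simp] theorem Polarity.opp_eq_plus {ε : Polarity} : ε.opp = .plus ↔ ε = .minus := by
  cases ε <;> simp [Polarity.opp]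

@[simp] theorem Polarity.opp_eq_minus {ε : Polarity} : ε.opp = .minus ↔ ε = .plus := by
  cases ε <;> simp [Polarity.opp]

@[simp] theorem Base.dual_dual (β : Base) : β.dual.dual = β := by cases β; simp [Base.dual]

@[simp] theorem Base.dual_polarity (β : Base) : β.dual.polarity = β.polarity.opp := rfl

@[simp] theorem Action.bar_bar (κ : Action) : κ.bar.bar = κ := by cases κ <;> simp [Action.bar]

@[simp] theorem Action.bar_comp_bar : Action.bar ∘ Action.bar = id := funext Action.bar_bar

@[simp] theorem Action.bar_daimon : Action.daimon.bar = .daimon := rfl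

@[simp] theorem Action.daimon_polarity : Action.daimon.polarity = .plus := rfl

@[simp] theorem Action.daimon_focus : Action.daimon.focus = none := rfl

@[simp] theorem Action.bar_focus (κ : Action) : κ.bar.focus = κ.focus := by cases κ <;> rfl

theorem Action.bar_injective : Function.Injective Action.bar :=
  Function.LeftInverse.injective Action.bar_bar

@[simp] theorem Action.bar_eq_daimon {κ : Action} : κ.bar = .daimon ↔ κ = .daimon := by
  cases κ <;> simp [Action.bar]

theorem Action.bar_polarity {κ : Action} (h : κ ≠ .daimon) : κ.bar.polarity = κ.polarity.opp := by
  cases κ with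
  | proper => rfl
  | daimon => exact absurd rfl h

theorem Action.ne_daimon_of_minus {κ : Action} (h : κ.polarity = .minus) : κ ≠ .daimon := by
  rintro rfl
  simp at h

theorem Action.focus_eq_none {κ : Action} : κ.focus = none ↔ κ = .daimon := by
  cases κ <;> simp [Action.focus]

@[simp] theorem map_bar_map_bar (w : List Action) : (w.map Action.bar).map Action.bar = w := by
  simp [Function.comp_def]

@[simp] theorem map_focus_map_bar (w : List Action) :
    (w.map Action.bar).map Action.focus = w.map Action.focus := by
  simp [Function.comp_def]

@[simp] theorem daimon_mem_map_bar {w : List Action} :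
    Action.daimon ∈ w.map Action.bar ↔ Action.daimon ∈ w := by
  simp

theorem justifies_bar {γ α : Action} : Justifies γ.bar α.bar ↔ Justifies γ α := by
  cases γ with
  | daimon => exact Iff.rfl
  | proper ε _ _ =>
    cases α with
    | daimon => exact Iff.rfl
    | proper ε' _ _ => cases ε <;> cases ε' <;> simp [Justifies, Action.bar, Polarity.opp]

theorem Justifies.ne_daimon_left {γ α : Action} (h : Justifies γ α) : γ ≠ .daimon := by
  rintro rfl
  cases α <;> exact h

theorem Justifies.ne_daimon_right {γ α : Action} (h : Justifies γ α) : α ≠ .daimon := by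
  rintro rfl
  cases γ <;> exact h

theorem Justifies.polarity {γ α : Action} (h : Justifies γ α) : α.polarity = γ.polarity.opp := by
  cases γ <;> cases α <;> first | exact h.1 | exact h.elim

/-- An address has a single parent. With distinct focuses this makes the justifier of an action
unique. -/
theorem Justifies.focus_eq {γ γ' α α' : Action} (h : Justifies γ α) (h' : Justifies γ' α')
    (e : α.focus = α'.focus) : γ.focus = γ'.focus := by
  cases γ <;> cases γ' <;> cases α <;> cases α' <;>
    first
    | exact h.elim
    | exact h'.elim
    | (obtain ⟨-, k, -, rfl⟩ := h
       obtain ⟨-, k', -, rfl⟩ := h'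
       simp only [Action.focus, Option.some.injEq] at e ⊢
       exact (List.append_inj' e rfl).1)

theorem Initial.ne_daimon {β : Base} {κ : Action} (h : Initial β κ) : κ ≠ .daimon := by
  rintro rfl
  simp [Initial] at h

theorem initial_dual_bar {β : Base} {κ : Action} : Initial β.dual κ.bar ↔ Initial β κ := by
  cases κ <;> simp [Initial, Base.dual, Action.bar, Action.focus, Action.polarity, Polarity.opp_inj]

/-! ### Sequences with pairwise distinct focuses -/

/-- The actions of `p` have pairwise distinct focuses; the daimon occurs at most once. -/
def Linear (p : List Action) : Prop := (p.map Action.focus).Nodup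

theorem Linear.nodup {p : List Action} (h : Linear p) : p.Nodup := List.Nodup.of_map _ h

theorem Linear.sublist {p q : List Action} (h : Linear p) (hq : q <+ p) : Linear q :=
  List.Nodup.sublist (hq.map _) h

theorem Linear.eq_of_focus_eq {p : List Action} (h : Linear p) {κ κ' : Action} (hκ : κ ∈ p)
    (hκ' : κ' ∈ p) (e : κ.focus = κ'.focus) : κ = κ' :=
  List.inj_on_of_nodup_map h hκ hκ' e

theorem linear_map_bar {p : List Action} : Linear (p.map Action.bar) ↔ Linear p := by
  simp only [Linear, map_focus_map_bar]

theorem linear_append_singleton {p : List Action} {κ : Action} :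
    Linear (p ++ [κ]) ↔ Linear p ∧ κ.focus ∉ p.map Action.focus := by
  simp only [Linear, List.map_append, List.nodup_append, List.map_cons, List.map_nil,
    List.nodup_cons, List.not_mem_nil, not_false_eq_true, List.nodup_nil, and_self, true_and,
    List.mem_singleton, forall_eq]
  constructor
  · rintro ⟨h, h'⟩
    exact ⟨h, fun hk => h' _ hk rfl⟩
  · rintro ⟨h, h'⟩
    exact ⟨h, fun a ha e => h' (e ▸ ha)⟩

theorem map_focus_eq_of_daimon_notMem {p : List Action} (h : Action.daimon ∉ p) :
    p.map Action.focus = (focuses p).map some := by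
  induction p with
  | nil => rfl
  | cons κ p ih =>
    simp only [List.mem_cons, not_or] at h
    cases κ with
    | proper ε ξ I => simp [focuses, Action.focus, ih h.2]
    | daimon => exact absurd rfl h.1

theorem linear_iff_of_daimon_notMem {p : List Action} (h : Action.daimon ∉ p) :
    Linear p ↔ (focuses p).Nodup := by
  rw [Linear, map_focus_eq_of_daimon_notMem h]
  exact List.nodup_map_iff (Option.some_injective _)

theorem focuses_append (p q : List Action) : focuses (p ++ q) = focuses p ++ focuses q := by
  simp [focuses]

@[simp] theorem focuses_daimon : focuses [.daimon] = [] := rfl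

/-! ### Removal of the daimon -/

/-- Whether an action is proper. -/
def Action.isProper : Action → Bool
  | .proper _ _ _ => true
  | .daimon => false

@[simp] theorem Action.isProper_eq_true {κ : Action} : κ.isProper = true ↔ κ ≠ .daimon := by
  cases κ <;> simp [Action.isProper]

@[simp] theorem Action.isProper_bar (κ : Action) : κ.bar.isProper = κ.isProper := by
  cases κ <;> rfl

/-- The subsequence of the proper actions. -/
def core (p : List Action) : List Action := p.filter Action.isProper

theorem mem_core {p : List Action} {κ : Action} : κ ∈ core p ↔ κ ∈ p ∧ κ ≠ .daimon := by
  simp [core]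

theorem daimon_notMem_core (p : List Action) : Action.daimon ∉ core p := by simp [mem_core]

theorem core_sublist (p : List Action) : core p <+ p := List.filter_sublist

theorem core_eq_self {p : List Action} (h : Action.daimon ∉ p) : core p = p := by
  rw [core, List.filter_eq_self]
  intro κ hκ
  rw [Action.isProper_eq_true]
  rintro rfl
  exact h hκ

theorem core_sublist_core {p q : List Action} (h : p <+ q) : core p <+ core q := h.filter _

theorem core_prefix_core {p q : List Action} (h : p <+: q) : core p <+: core q :=
  h.filter _

@[simp] theorem core_append (p q : List Action) : core (p ++ q) = core p ++ core q := by
  simp [core]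

@[simp] theorem core_daimon : core [.daimon] = [] := rfl

theorem core_map_bar (p : List Action) : core (p.map Action.bar) = (core p).map Action.bar := by
  simp [core, List.filter_map, Function.comp_def]

theorem eq_core_or {p : List Action} (h : Action.daimon ∉ p.dropLast) :
    p = core p ∨ p = core p ++ [.daimon] := by
  rcases eq_nil_or_append_singleton p with rfl | ⟨l, κ, rfl⟩
  · exact .inl rfl
  · rw [List.dropLast_concat] at h
    by_cases hκ : κ = .daimon
    · subst hκ
      right
      rw [core_append, core_daimon, List.append_nil, core_eq_self h]
    · left
      rw [core_eq_self]
      simp only [List.mem_append, List.mem_singleton, not_or]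
      exact ⟨h, fun e => hκ e.symm⟩

theorem core_dual (p : List Action) : core (dual p) = (core p).map Action.bar := by
  rw [dual]
  split_ifs with h
  · rcases eq_nil_or_append_singleton p with rfl | ⟨l, κ, rfl⟩
    · simp at h
    · simp only [List.getLast?_append, List.getLast?_singleton, Option.some_or,
        Option.some.injEq] at h
      subst h
      rw [List.dropLast_concat, core_map_bar, core_append, core_daimon, List.append_nil]
  · rw [core_append, core_map_bar, core_daimon, List.append_nil]

theorem dual_append_daimon (w : List Action) : dual (w ++ [.daimon]) = w.map Action.bar := by
  simp [dual]

theorem dual_of_daimon_notMem {w : List Action} (h : Action.daimon ∉ w) :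
    dual w = w.map Action.bar ++ [.daimon] := by
  rw [dual, if_neg]
  intro e
  exact h (List.mem_of_getLast? e)

/-! ### Justified sequences -/

/-- Every proper action of `w` is initial or justified by an earlier one. -/
def Justified (β : Base) (w : List Action) : Prop :=
  ∀ l κ r, w = l ++ κ :: r → κ ≠ .daimon → Initial β κ ∨ ∃ κ' ∈ l, Justifies κ' κ

theorem Justified.of_append {β : Base} {l r : List Action} (h : Justified β (l ++ r)) :
    Justified β l := by
  rintro l₁ κ l₂ rfl hκ
  exact h l₁ κ (l₂ ++ r) (by simp) hκ

theorem justified_append_singleton {β : Base} {w : List Action} {κ : Action}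
    (h : Justified β w) (hκ : κ ≠ .daimon → Initial β κ ∨ ∃ κ' ∈ w, Justifies κ' κ) :
    Justified β (w ++ [κ]) := by
  intro l a r e ha
  rcases eq_nil_or_append_singleton r with rfl | ⟨r', b, rfl⟩
  · obtain ⟨rfl, e'⟩ := List.append_inj' e rfl
    simp only [List.cons.injEq, and_true] at e'
    subst e'
    exact hκ ha
  · have e' : w ++ [κ] = (l ++ a :: r') ++ [b] := by simpa using e
    obtain ⟨rfl, -⟩ := List.append_inj' e' rfl
    exact h l a r' rfl ha

theorem Justified.map_bar {β : Base} {w : List Action} (h : Justified β w) :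
    Justified β.dual (w.map Action.bar) := by
  intro l κ r e hκ
  have e' : w = l.map Action.bar ++ κ.bar :: r.map Action.bar := by
    have := congrArg (List.map Action.bar) e
    simpa using this
  rcases h _ _ _ e' (by simpa using hκ) with h | ⟨κ', hm, hj⟩
  · left
    rw [← initial_dual_bar] at h
    simpa using h
  · right
    rw [List.mem_map] at hm
    obtain ⟨γ, hγ, rfl⟩ := hm
    exact ⟨γ, hγ, justifies_bar.1 hj⟩

/-- Justification adds one entry to the focus, starting from the address of the base. Hence no
action justified within `w` can have that address as focus. -/
theorem Justified.length_le {β : Base} {w : List Action} (h : Justified β w) :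
    ∀ κ ∈ w, ∀ σ, κ.focus = some σ → β.addr.length ≤ σ.length := by
  induction w using List.reverseRecOn with
  | nil => simp
  | append_singleton w a ih =>
    intro κ hκ σ hσ
    rcases List.mem_append.1 hκ with hκ | hκ
    · exact ih h.of_append κ hκ σ hσ
    · rw [List.mem_singleton] at hκ
      subst hκ
      rcases h w κ [] rfl (by rintro rfl; simp at hσ) with h' | ⟨γ, hγ, hj⟩
      · rw [h'.1] at hσ
        simp only [Option.some.injEq] at hσ
        rw [hσ]
      · cases γ with
        | daimon => exact absurd rfl hj.ne_daimon_left
        | proper ε τ I =>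
          cases κ with
          | daimon => simp at hσ
          | proper ε' τ' I' =>
            obtain ⟨-, k, -, rfl⟩ := hj
            simp only [Action.focus, Option.some.injEq] at hσ
            have := ih h.of_append _ hγ τ rfl
            rw [← hσ, List.length_append]
            omega

theorem Justified.focus_ne {β : Base} {w : List Action} (h : Justified β w) {γ α : Action}
    (hγ : γ ∈ w) (hj : Justifies γ α) : α.focus ≠ some β.addr := by
  intro hi
  cases γ with
  | daimon => exact absurd rfl hj.ne_daimon_left
  | proper ε τ I =>
    cases α with
    | daimon => exact absurd rfl hj.ne_daimon_right
    | proper ε' τ' I' =>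
      have h1 := h.length_le _ hγ τ rfl
      obtain ⟨-, k, -, rfl⟩ := hj
      simp only [Action.focus, Option.some.injEq] at hi
      rw [← hi, List.length_append] at h1
      simp at h1

theorem Justified.not_initial {β : Base} {w : List Action} (h : Justified β w) {γ α : Action}
    (hγ : γ ∈ w) (hj : Justifies γ α) : ¬ Initial β α :=
  fun hi => h.focus_ne hγ hj hi.1

/-- `Justified` provides a justifier on the left, and linearity leaves no other action with the
parent focus. -/
theorem Justified.mem_left {β : Base} {l r : List Action} {γ α : Action}
    (h : Justified β (l ++ α :: r)) (hl : Linear (l ++ α :: r)) (hγ : γ ∈ l ++ α :: r)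
    (hj : Justifies γ α) : γ ∈ l := by
  rcases h l α r rfl hj.ne_daimon_right with h' | ⟨γ', hγ', hj'⟩
  · exact absurd h' (h.not_initial hγ hj)
  · have : γ = γ' := hl.eq_of_focus_eq hγ (by simp [hγ']) (hj.focus_eq hj' rfl)
    rwa [this]

theorem Justified.eq_nil_of_initial {β : Base} {l r : List Action} {κ : Action}
    (h : Justified β (l ++ κ :: r)) (hl : Linear (l ++ κ :: r)) (hd : Action.daimon ∉ l)
    (hi : Initial β κ) : l = [] := by
  cases l with
  | nil => rfl
  | cons x l =>
    exfalso
    rcases h [] x (l ++ κ :: r) rfl (by rintro rfl; simp at hd) with hx | ⟨_, hx, -⟩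
    · have : x = κ := hl.eq_of_focus_eq (by simp) (by simp) (hx.1.trans hi.1.symm)
      subst this
      have := hl.nodup
      simp at this
    · simp at hx

/-! ### Sequences of justifiers -/

theorem IsJustifierSequence.mono {β : Base} {p q : List Action} {κ : Action} {t : List Action}
    (h : IsJustifierSequence β p κ t) (hpq : p <+ q) : IsJustifierSequence β q κ t :=
  ⟨h.1.trans hpq, h.2⟩

theorem daimon_notMem_of_isChain {t : List Action} {κ₀ : Action} (h : t.IsChain Justifies)
    (h₀ : t.head? = some κ₀) (hκ : κ₀ ≠ .daimon) : Action.daimon ∉ t := by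
  induction t generalizing κ₀ with
  | nil => simp
  | cons a t ih =>
    simp only [List.head?_cons, Option.some.injEq] at h₀
    subst h₀
    cases t with
    | nil => simpa using hκ.symm
    | cons b t =>
      rw [List.isChain_cons_cons] at h
      have := ih h.2 rfl h.1.ne_daimon_right
      rw [List.mem_cons, not_or]
      exact ⟨hκ.symm, this⟩

theorem IsJustifierSequence.daimon_notMem {β : Base} {p : List Action} {κ : Action}
    {t : List Action} (h : IsJustifierSequence β p κ t) : Action.daimon ∉ t := by
  obtain ⟨-, -, hc, κ₀, h₀, hi⟩ := h
  exact daimon_notMem_of_isChain hc h₀ hi.ne_daimon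

theorem isJustifierSequence_core {β : Base} {p : List Action} {κ : Action} {t : List Action} :
    IsJustifierSequence β (core p) κ t ↔ IsJustifierSequence β p κ t := by
  refine ⟨fun h => h.mono (core_sublist p), fun h => ⟨?_, h.2⟩⟩
  rw [← core_eq_self h.daimon_notMem]
  exact core_sublist_core h.1

theorem IsJustifierSequence.map_bar {β : Base} {p : List Action} {κ : Action} {t : List Action}
    (h : IsJustifierSequence β p κ t) :
    IsJustifierSequence β.dual (p.map Action.bar) κ.bar (t.map Action.bar) := by
  obtain ⟨hs, hl, hc, κ₀, h₀, hi⟩ := h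
  refine ⟨hs.map _, by simp [hl], ?_, κ₀.bar, by simp [h₀], initial_dual_bar.2 hi⟩
  rw [List.isChain_map]
  exact hc.imp fun a b h => justifies_bar.2 h

theorem Justified.exists_isJustifierSequence {β : Base} {w : List Action} {κ : Action}
    (h : Justified β (w ++ [κ])) (hκ : κ ≠ .daimon) :
    ∃ t, IsJustifierSequence β (w ++ [κ]) κ t := by
  induction hn : w.length using Nat.strong_induction_on generalizing w κ with
  | _ n ih =>
    rcases h w κ [] rfl hκ with hi | ⟨γ, hγ, hj⟩
    · exact ⟨[κ], List.sublist_append_right w [κ], by simp, by simp, κ, by simp, hi⟩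
    · obtain ⟨l, r, rfl⟩ := List.mem_iff_append.1 hγ
      have h' : Justified β (l ++ [γ]) :=
        Justified.of_append (r := r ++ [κ]) (by simpa using h)
      obtain ⟨t, ht, hl, hc, κ₀, h₀, hi⟩ :=
        ih l.length (by rw [← hn]; simp) h' hj.ne_daimon_left rfl
      refine ⟨t ++ [κ], ?_, by simp, ?_, κ₀, by simp [h₀], hi⟩
      · refine List.Sublist.append (ht.trans ?_) (List.Sublist.refl _)
        exact (List.Sublist.refl l).append (by simp)
      · rw [List.isChain_append]
        refine ⟨hc, by simp, ?_⟩
        rw [hl]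
        simpa using hj

/-- Read the sequences backwards: the focus of an action fixes that of its justifier, and linearity
then fixes the justifier. -/
theorem IsJustifierSequence.unique {β : Base} {p : List Action} (hp : Linear p) {κ : Action}
    {t t' : List Action} (h : IsJustifierSequence β p κ t) (h' : IsJustifierSequence β p κ t') :
    t = t' := by
  induction t using List.reverseRecOn generalizing κ t' with
  | nil => simp [IsJustifierSequence] at h
  | append_singleton s a ih =>
    rcases eq_nil_or_append_singleton t' with rfl | ⟨s', b, rfl⟩
    · simp [IsJustifierSequence] at h'
    obtain ⟨hs, hl, hc, κ₀, h₀, hi⟩ := h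
    obtain ⟨hs', hl', hc', κ₁, h₁, hi'⟩ := h'
    simp only [List.getLast?_append, List.getLast?_singleton, Option.some_or,
      Option.some.injEq] at hl hl'
    subst hl hl'
    -- Both sequences stop at the same place: an initial last action has the focus of the initial
    -- head, so it is the head.
    have key : ∀ {s : List Action} {κ₀ : Action}, s ++ [b] <+ p →
        (s ++ [b]).head? = some κ₀ → Initial β κ₀ → Initial β b → s = [] := by
      intro s κ₀ hs h₀ hi hb
      cases s with
      | nil => rfl
      | cons x s =>
        simp only [List.cons_append, List.head?_cons, Option.some.injEq] at h₀
        subst h₀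
        have hl := hp.sublist hs
        have := hl.eq_of_focus_eq (κ := x) (κ' := b) (by simp) (by simp) (hi.1.trans hb.1.symm)
        subst this
        simpa using hl.nodup
    rcases eq_nil_or_append_singleton s with rfl | ⟨s, x, rfl⟩
    · simp only [List.nil_append, List.head?_cons, Option.some.injEq] at h₀
      subst h₀
      rw [key hs' h₁ hi' hi]
    · rcases eq_nil_or_append_singleton s' with rfl | ⟨s', x', rfl⟩
      · simp only [List.nil_append, List.head?_cons, Option.some.injEq] at h₁
        subst h₁
        exact absurd (key hs h₀ hi hi') (by simp)
      · rw [List.isChain_append] at hc hc'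
        have hx : Justifies x b := by simpa using hc.2.2
        have hx' : Justifies x' b := by simpa using hc'.2.2
        have e : x = x' := hp.eq_of_focus_eq (hs.subset (by simp)) (hs'.subset (by simp))
          (hx.focus_eq hx' rfl)
        subst e
        congr 1
        refine ih (κ := x) ⟨(List.sublist_append_left _ _).trans hs, by simp, hc.1, κ₀, ?_, hi⟩
          ⟨(List.sublist_append_left _ _).trans hs', by simp, hc'.1, κ₁, ?_, hi'⟩
        · rw [← h₀]; cases s <;> rfl
        · rw [← h₁]; cases s' <;> rfl

/-! ### Negative jumps -/

theorem NegJump.mono {p q : List Action} (hpq : p <:+: q) {κ' κ : Action} (h : NegJump p κ' κ) :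
    NegJump q κ' κ := by
  induction h with
  | direct h => exact .direct (h.trans hpq)
  | step h hγ hj _ ih => exact .step (h.trans hpq) (hpq.subset hγ) hj ih

theorem NegJump.mem_left {p : List Action} {κ' κ : Action} (h : NegJump p κ' κ) : κ' ∈ p := by
  induction h with
  | direct h => exact h.subset (by simp)
  | step _ _ _ _ ih => exact ih

theorem NegJump.map_bar {p : List Action} {κ' κ : Action} (h : NegJump p κ' κ) :
    NegJump (p.map Action.bar) κ'.bar κ.bar := by
  induction h with
  | direct h => exact .direct (h.map Action.bar)
  | step h hγ hj _ ih =>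
    exact .step (h.map Action.bar) (List.mem_map_of_mem hγ) (justifies_bar.2 hj) ih

theorem infix_of_mem_left {l r : List Action} {a κ : Action} (hn : (l ++ r).Nodup) (hκ : κ ∈ l)
    (h : [a, κ] <:+: l ++ r) : [a, κ] <:+: l := by
  obtain ⟨l₁, l₂, rfl⟩ := List.mem_iff_append.1 hκ
  obtain ⟨s, t, e⟩ := h
  have e' : l₁ ++ κ :: (l₂ ++ r) = (s ++ [a]) ++ κ :: t := by simpa using e.symm
  obtain ⟨rfl, -⟩ := append_cons_inj_of_nodup (by simpa using hn) e'
  exact ⟨s, l₂, by simp⟩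

theorem infix_of_mem_right {l r : List Action} {a b κ : Action} (hn : (l ++ b :: r).Nodup)
    (hκ : κ ∈ r) (h : [a, κ] <:+: l ++ b :: r) : [a, κ] <:+: b :: r := by
  obtain ⟨r₁, r₂, rfl⟩ := List.mem_iff_append.1 hκ
  obtain ⟨s, t, e⟩ := h
  have e' : (l ++ b :: r₁) ++ κ :: r₂ = (s ++ [a]) ++ κ :: t := by simpa using e.symm
  obtain ⟨e₁, -⟩ := append_cons_inj_of_nodup (by simpa using hn) e'
  rcases eq_nil_or_append_singleton r₁ with rfl | ⟨r₁, c, rfl⟩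
  · obtain ⟨-, e₂⟩ := List.append_inj' e₁ rfl
    simp only [List.cons.injEq, and_true] at e₂
    subst e₂
    exact ⟨[], r₂, by simp⟩
  · have e₂ : (l ++ b :: r₁) ++ [c] = s ++ [a] := by simpa using e₁
    obtain ⟨-, e₂⟩ := List.append_inj' e₂ rfl
    simp only [List.cons.injEq, and_true] at e₂
    subst e₂
    exact ⟨b :: r₁, r₂, by simp⟩

/-- A jump only moves backwards, to a predecessor and then to its justifier, so it never leaves the
prefix where it starts. -/
theorem NegJump.of_mem_left {β : Base} {l r : List Action} (hn : Linear (l ++ r))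
    (hj : Justified β (l ++ r)) {κ' κ : Action} (hκ : κ ∈ l) (h : NegJump (l ++ r) κ' κ) :
    NegJump l κ' κ := by
  induction h with
  | direct h => exact .direct (infix_of_mem_left hn.nodup hκ h)
  | @step κ α γ h hγ hγα _ ih =>
    have h' := infix_of_mem_left hn.nodup hκ h
    obtain ⟨l₁, l₂, e⟩ := List.mem_iff_append.1 (h'.subset (by simp : α ∈ [α, κ]))
    have hl : γ ∈ l := by
      subst e
      have : γ ∈ l₁ := Justified.mem_left (r := l₂ ++ r) (by simpa using hj) (by simpa using hn)
        (by simpa using hγ) hγα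
      simp [this]
    exact .step h' hl hγα (ih hl)

/-! ### Plays: the common part of a reversible path and its dual -/

/-- Sequences of proper actions subject to the path conditions for both polarities. -/
structure Play (β : Base) (w : List Action) : Prop where
  proper : Action.daimon ∉ w
  alternation : w.IsChain (fun κ κ' => κ.polarity ≠ κ'.polarity)
  justified : Justified β w
  jump : ∀ κ ∈ w, ∀ κ' ∈ w, Justifies κ' κ → NegJump w κ' κ
  linear : Linear w

theorem isChain_polarity_map_bar {w : List Action} (h : Action.daimon ∉ w)
    (hc : w.IsChain (fun κ κ' => κ.polarity ≠ κ'.polarity)) :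
    (w.map Action.bar).IsChain (fun κ κ' => κ.polarity ≠ κ'.polarity) := by
  rw [List.isChain_map]
  induction w with
  | nil => simp
  | cons a w ih =>
    cases w with
    | nil => simp
    | cons b w =>
      rw [List.isChain_cons_cons] at hc ⊢
      simp only [List.mem_cons, not_or] at h
      refine ⟨?_, ih (by simpa using h.2) hc.2⟩
      rw [Action.bar_polarity (Ne.symm h.1), Action.bar_polarity (Ne.symm h.2.1), Ne,
        Polarity.opp_inj]
      exact hc.1

theorem play_nil (β : Base) : Play β [] :=
  ⟨by simp, by simp, fun l κ r h => by simp at h, by simp, by simp [Linear]⟩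

theorem Play.map_bar {β : Base} {w : List Action} (h : Play β w) :
    Play β.dual (w.map Action.bar) where
  proper := by simpa using h.proper
  alternation := isChain_polarity_map_bar h.proper h.alternation
  justified := h.justified.map_bar
  jump := by
    intro κ hκ κ' hκ' hj
    obtain ⟨α, hα, rfl⟩ := List.mem_map.1 hκ
    obtain ⟨γ, hγ, rfl⟩ := List.mem_map.1 hκ'
    exact (h.jump α hα γ hγ (justifies_bar.1 hj)).map_bar
  linear := linear_map_bar.2 h.linear

theorem Play.of_append {β : Base} {l r : List Action} (h : Play β (l ++ r)) : Play β l where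
  proper := fun hd => h.proper (by simp [hd])
  alternation := h.alternation.prefix (List.prefix_append _ _)
  justified := h.justified.of_append
  jump := fun κ hκ κ' hκ' hj => NegJump.of_mem_left h.linear h.justified hκ
    (h.jump κ (by simp [hκ]) κ' (by simp [hκ']) hj)
  linear := h.linear.sublist (List.sublist_append_left _ _)

theorem Play.append_singleton {β : Base} {w : List Action} (h : Play β w) {κ : Action}
    (hκ : κ ≠ .daimon) (hp : ∀ κ' ∈ w.getLast?, κ'.polarity ≠ κ.polarity)
    (hf : κ.focus ∉ w.map Action.focus)
    (hj : Initial β κ ∨ ∃ κ' ∈ w, Justifies κ' κ ∧ NegJump (w ++ [κ]) κ' κ) :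
    Play β (w ++ [κ]) := by
  have hlin : Linear (w ++ [κ]) := linear_append_singleton.2 ⟨h.linear, hf⟩
  have hjust : Justified β (w ++ [κ]) := by
    refine justified_append_singleton h.justified fun _ => ?_
    rcases hj with hj | ⟨κ', h₁, h₂, -⟩
    exacts [.inl hj, .inr ⟨κ', h₁, h₂⟩]
  refine ⟨?_, ?_, hjust, ?_, hlin⟩
  · simp only [List.mem_append, List.mem_singleton, not_or]
    exact ⟨h.proper, hκ.symm⟩
  · rw [List.isChain_append]
    exact ⟨h.alternation, by simp, by simpa using hp⟩
  · intro a ha b hb hba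
    rcases List.mem_append.1 ha with ha | ha
    · have hb' : b ∈ w := by
        obtain ⟨l₁, l₂, rfl⟩ := List.mem_iff_append.1 ha
        have := Justified.mem_left (r := l₂ ++ [κ]) (by simpa using hjust) (by simpa using hlin)
          (by simpa using hb) hba
        simp [this]
      exact (h.jump a ha b hb' hba).mono (List.prefix_append _ _).isInfix
    · rw [List.mem_singleton] at ha
      subst ha
      rcases hj with hj | ⟨κ', h₁, h₂, h₃⟩
      · exact absurd hj (hjust.not_initial hb hba)
      · have : b = κ' := hlin.eq_of_focus_eq hb (by simp [h₁]) (hba.focus_eq h₂ rfl)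
        rwa [this]

/-- The polarity of the next action of a sequence on the base `β`. -/
def turn (β : Base) (w : List Action) : Polarity :=
  match w.getLast? with
  | none => β.polarity
  | some κ => κ.polarity.opp

@[simp] theorem turn_nil (β : Base) : turn β [] = β.polarity := rfl

@[simp] theorem turn_append_singleton (β : Base) (w : List Action) (κ : Action) :
    turn β (w ++ [κ]) = κ.polarity.opp := by
  simp [turn]

theorem turn_dual_map_bar {β : Base} {w : List Action} (h : Action.daimon ∉ w) :
    turn β.dual (w.map Action.bar) = (turn β w).opp := by
  rcases eq_nil_or_append_singleton w with rfl | ⟨w, κ, rfl⟩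
  · simp
  · have hκ : κ ≠ .daimon := by rintro rfl; simp at h
    rw [List.map_append, List.map_singleton, turn_append_singleton, turn_append_singleton,
      Action.bar_polarity hκ]

/-- Completion of a sequence of proper actions into a positive-ended sequence. -/
def close (β : Base) (w : List Action) : List Action :=
  match turn β w with
  | .plus => w ++ [.daimon]
  | .minus => w

theorem close_of_plus {β : Base} {w : List Action} (h : turn β w = .plus) :
    close β w = w ++ [.daimon] := by
  rw [close, h]

theorem close_of_minus {β : Base} {w : List Action} (h : turn β w = .minus) :
    close β w = w := by
  rw [close, h]

theorem turn_cases (β : Base) (w : List Action) : turn β w = .plus ∨ turn β w = .minus := by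
  cases turn β w <;> simp

/-- Reversal flips `turn`, so exactly one of a play and its reversal receives the daimon. This is
why duality can be handled on plays by `bar` alone. -/
theorem dual_close {β : Base} {w : List Action} (h : Action.daimon ∉ w) :
    dual (close β w) = close β.dual (w.map Action.bar) := by
  rcases turn_cases β w with ht | ht
  · rw [close_of_plus ht, dual_append_daimon, close_of_minus]
    rw [turn_dual_map_bar h, ht]
    rfl
  · rw [close_of_minus ht, dual_of_daimon_notMem h, close_of_plus]
    rw [turn_dual_map_bar h, ht]
    rfl

theorem dual_dual_close {β : Base} {w : List Action} (h : Action.daimon ∉ w) :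
    dual (dual (close β w)) = close β w := by
  rw [dual_close h, dual_close (by simpa using h), map_bar_map_bar, Base.dual_dual]

theorem positiveEnded_close (β : Base) (w : List Action) : PositiveEnded (close β w) := by
  rcases turn_cases β w with ht | ht
  · rw [close_of_plus ht]
    simp [PositiveEnded]
  · rw [close_of_minus ht]
    rcases eq_nil_or_append_singleton w with rfl | ⟨w, κ, rfl⟩
    · simp [PositiveEnded]
    · simpa [PositiveEnded] using ht

theorem IsPath.justified {β : Base} {p : List Action} (h : IsPath β p) : Justified β p := by
  rintro l κ r rfl hκ
  exact h.justification l κ ⟨r, by simp⟩ hκ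

theorem IsPath.linear {β : Base} {p : List Action} (h : IsPath β p) : Linear p := by
  rcases eq_core_or h.daimon_last with e | e
  · rw [linear_iff_of_daimon_notMem (by rw [e]; exact daimon_notMem_core p)]
    exact h.linearity
  · have h1 := h.linearity
    rw [e, focuses_append, focuses_daimon, List.append_nil,
      ← linear_iff_of_daimon_notMem (daimon_notMem_core p)] at h1
    rw [e, linear_append_singleton]
    refine ⟨h1, fun hm => ?_⟩
    obtain ⟨a, ha, hf⟩ := List.mem_map.1 hm
    rw [Action.daimon_focus, Action.focus_eq_none] at hf
    exact daimon_notMem_core p (hf ▸ ha)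

theorem Play.isPath_close {β : Base} {w : List Action} (h : Play β w) : IsPath β (close β w) := by
  rcases turn_cases β w with ht | ht
  · rw [close_of_plus ht]
    have hm : ∀ κ ∈ w, κ ≠ .daimon := fun κ hκ e => h.proper (e ▸ hκ)
    refine ⟨?_, ?_, ?_, ?_, ?_, ?_, ?_⟩
    · rw [List.isChain_append]
      refine ⟨h.alternation, by simp, ?_⟩
      rcases eq_nil_or_append_singleton w with rfl | ⟨w, κ, rfl⟩
      · simp
      · simpa using ht
    · rintro l κ ⟨r, e⟩ hκ
      exact justified_append_singleton h.justified (fun h => absurd rfl h) l κ r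
        (by simpa using e.symm) hκ
    · intro κ hκ κ' hκ' _ hj
      have h₁ : κ ∈ w := by simpa [hj.ne_daimon_right] using hκ
      have h₂ : κ' ∈ w := by simpa [hj.ne_daimon_left] using hκ'
      exact (h.jump κ h₁ κ' h₂ hj).mono (List.prefix_append _ _).isInfix
    · rw [focuses_append, focuses_daimon, List.append_nil,
        ← linear_iff_of_daimon_notMem h.proper]
      exact h.linear
    · rw [List.dropLast_concat]
      exact h.proper
    · cases w with
      | nil => simpa using ht
      | cons a w =>
        intro e
        simp only [List.cons_append, List.head?_cons, Option.some.injEq] at e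
        exact absurd e (hm a (by simp))
    · intro _
      cases w with
      | nil => exact ⟨.daimon, rfl, .inl rfl⟩
      | cons a w =>
        refine ⟨a, rfl, .inr ?_⟩
        simpa using h.justified [] a w rfl (hm a (by simp))
  · rw [close_of_minus ht]
    have hm : ∀ κ ∈ w, κ ≠ .daimon := fun κ hκ e => h.proper (e ▸ hκ)
    refine ⟨h.alternation, ?_, fun κ hκ κ' hκ' _ hj => h.jump κ hκ κ' hκ' hj,
      (linear_iff_of_daimon_notMem h.proper).1 h.linear,
      fun hd => h.proper (List.mem_of_mem_dropLast hd), ?_, ?_⟩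
    · rintro l κ ⟨r, e⟩ hκ
      exact h.justified l κ r (by simpa using e.symm) hκ
    · intro e
      exact absurd (List.mem_of_head? e) h.proper
    · intro hβ
      cases w with
      | nil => simp [hβ] at ht
      | cons a w =>
        refine ⟨a, rfl, .inr ?_⟩
        simpa using h.justified [] a w rfl (hm a (by simp))

theorem Play.reversible {β : Base} {w : List Action} (h : Play β w) :
    Reversible β (close β w) := by
  refine ⟨h.isPath_close, positiveEnded_close _ _, ?_, ?_⟩
  · rw [dual_close h.proper]
    exact h.map_bar.isPath_close
  · rw [dual_close h.proper]
    exact positiveEnded_close _ _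

theorem IsPath.eq_close {β : Base} {p : List Action} (h : IsPath β p) (hp : PositiveEnded p) :
    p = close β (core p) := by
  rcases eq_core_or h.daimon_last with e | e
  · rw [close_of_minus, ← e]
    rcases eq_nil_or_append_singleton p with rfl | ⟨l, κ, rfl⟩
    · by_contra hc
      obtain ⟨κ, hκ, -⟩ := h.totality (by simpa [core] using hc)
      simp at hκ
    · rw [← e, turn_append_singleton, Polarity.opp_eq_minus]
      exact hp κ (by simp)
  · rw [close_of_plus, ← e]
    have ha := h.alternation
    have hd := h.daimon_first
    rw [e] at ha hd
    rcases eq_nil_or_append_singleton (core p) with e' | ⟨l, κ, e'⟩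
    · rw [e'] at hd ⊢
      exact hd rfl
    · rw [e', List.isChain_append] at ha
      rw [e', turn_append_singleton, Polarity.opp_eq_plus]
      simpa using ha.2.2

theorem IsPath.prefix_core {β : Base} {p : List Action} (h : IsPath β p) :
    ∃ r, p = core p ++ r := by
  rcases eq_core_or h.daimon_last with e | e
  exacts [⟨[], by simpa using e⟩, ⟨_, e⟩]

theorem IsPath.play_core {β : Base} {p : List Action} (h : IsPath β p)
    (hj : ∀ κ ∈ core p, ∀ κ' ∈ core p, κ.polarity = .minus → Justifies κ' κ →
      NegJump (core p) κ' κ) : Play β (core p) := by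
  obtain ⟨r, e⟩ := h.prefix_core
  have hl := h.linear
  have hju := h.justified
  have ha := h.alternation
  rw [e] at hl hju ha
  refine ⟨daimon_notMem_core p, ha.prefix (List.prefix_append _ _), hju.of_append, ?_,
    hl.sublist (List.sublist_append_left _ _)⟩
  intro κ hκ κ' hκ' hjj
  by_cases hp : κ.polarity = .plus
  · have h₁ := h.negativeJump κ ((core_sublist p).subset hκ) κ' ((core_sublist p).subset hκ') hp hjj
    rw [e] at h₁
    exact NegJump.of_mem_left hl hju hκ h₁
  · exact hj κ hκ κ' hκ' (by simpa using hp) hjj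

/-- The path condition on `p` controls the jumps of positive actions, and the one on the dual
controls those of negative actions. -/
theorem Reversible.play_core {β : Base} {p : List Action} (h : Reversible β p) :
    Play β (core p) := by
  refine h.1.play_core fun κ hκ κ' hκ' hp hj => ?_
  have hd := h.2.2.1
  obtain ⟨r, e⟩ := hd.prefix_core
  have hl := hd.linear
  have hju := hd.justified
  have hb : ∀ {a}, a ∈ core p → a.bar ∈ core (dual p) := fun ha => by
    rw [core_dual]; exact List.mem_map_of_mem ha
  have h₁ := hd.negativeJump κ.bar ((core_sublist _).subset (hb hκ)) κ'.bar
    ((core_sublist _).subset (hb hκ')) (by rw [Action.bar_polarity hj.ne_daimon_right, hp]; rfl)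
    (justifies_bar.2 hj)
  rw [e] at h₁ hl hju
  have h₂ := (NegJump.of_mem_left hl hju (hb hκ) h₁).map_bar
  simpa [core_dual] using h₂

theorem Reversible.eq_close {β : Base} {p : List Action} (h : Reversible β p) :
    p = close β (core p) := h.1.eq_close h.2.1

theorem Reversible.dual_dual {β : Base} {p : List Action} (h : Reversible β p) :
    dual (dual p) = p := by
  have := dual_dual_close (β := β) (daimon_notMem_core p)
  rwa [← h.eq_close] at this

theorem Reversible.dual {β : Base} {p : List Action} (h : Reversible β p) :
    Reversible β.dual (dual p) := by
  rw [h.eq_close, dual_close (daimon_notMem_core p)]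
  exact h.play_core.map_bar.reversible

theorem IsChronicle.infix_of_minus {β : Base} {l r : List Action} {κ : Action}
    (h : IsChronicle β (l ++ κ :: r)) (hκ : κ.polarity = .minus) (hi : ¬ Initial β κ) :
    ∃ l' κ', l = l' ++ [κ'] ∧ Justifies κ' κ := by
  obtain ⟨κ', h₁, h₂⟩ := h.negative_justified l κ ⟨r, by simp⟩ hκ hi
  obtain ⟨l', rfl⟩ := List.getLast?_eq_some_iff.1 h₁
  exact ⟨l', κ', rfl, h₂⟩

/-- A justified negative action of a chronicle directly follows its justifier, so the jump missing
from the path condition is a `direct` one. -/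
theorem IsChronicle.play_core {β : Base} {c : List Action} (h : IsChronicle β c) :
    Play β (core c) := by
  refine h.isPath.play_core fun κ hκ κ' hκ' hp hj => ?_
  obtain ⟨r, e⟩ := h.isPath.prefix_core
  obtain ⟨l₁, l₂, e'⟩ := List.mem_iff_append.1 hκ
  have hc := h
  rw [e, e', List.append_assoc, List.cons_append] at hc
  have hmem : ∀ {a}, a ∈ core c → a ∈ l₁ ++ κ :: (l₂ ++ r) := fun {a} ha => by
    rw [← List.cons_append, ← List.append_assoc, ← e', List.mem_append]; exact .inl ha
  obtain ⟨l', γ, rfl, hγ⟩ := hc.infix_of_minus hp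
    (hc.isPath.justified.not_initial (hmem hκ') hj)
  have : κ' = γ := hc.isPath.linear.eq_of_focus_eq (hmem hκ') (by simp) (hj.focus_eq hγ rfl)
  subst this
  refine .direct ?_
  rw [e']
  exact ⟨l', l₂, by simp⟩

theorem IsChronicle.reversible {β : Base} {c : List Action} (h : IsChronicle β c)
    (hc : PositiveEnded c) : Reversible β c := by
  rw [h.isPath.eq_close hc]
  exact h.play_core.reversible

/-! ### Interaction with history -/

/-- The net that remains after the actions of `w` have been visited in `R`. -/
def residuals (R : Set (List Action)) (w : List Action) : Set (List Action) := w.foldl residual R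

@[simp] theorem residuals_cons (R : Set (List Action)) (κ : Action) (w : List Action) :
    residuals R (κ :: w) = residuals (residual R κ) w := rfl

theorem residuals_append (R : Set (List Action)) (w w' : List Action) :
    residuals R (w ++ w') = residuals (residuals R w) w' := List.foldl_append

/-- The proper actions of `w` can be visited in `R` one after the other. -/
def Runs (R : Set (List Action)) (w : List Action) : Prop :=
  ∀ l κ r, w = l ++ κ :: r → κ ≠ .daimon ∧ [κ] ∈ residuals R l

theorem runs_nil (R : Set (List Action)) : Runs R [] := by
  intro l κ r h
  simp at h

theorem runs_cons {R : Set (List Action)} {κ : Action} {w : List Action} :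
    Runs R (κ :: w) ↔ κ ≠ .daimon ∧ [κ] ∈ R ∧ Runs (residual R κ) w := by
  constructor
  · intro h
    obtain ⟨h₁, h₂⟩ := h [] κ w rfl
    refine ⟨h₁, h₂, ?_⟩
    rintro l a r rfl
    exact h (κ :: l) a r rfl
  · rintro ⟨h₁, h₂, h₃⟩ l a r e
    cases l with
    | nil =>
      simp only [List.nil_append, List.cons.injEq] at e
      obtain ⟨rfl, -⟩ := e
      exact ⟨h₁, h₂⟩
    | cons b l =>
      simp only [List.cons_append, List.cons.injEq] at e
      obtain ⟨rfl, e⟩ := e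
      exact h₃ l a r e

theorem Runs.of_append {R : Set (List Action)} {w w' : List Action} (h : Runs R (w ++ w')) :
    Runs R w := by
  rintro l κ r rfl
  exact h l κ (r ++ w') (by simp)

theorem Runs.proper {R : Set (List Action)} {w : List Action} (h : Runs R w) :
    Action.daimon ∉ w := by
  intro hd
  obtain ⟨l, r, e⟩ := List.mem_iff_append.1 hd
  exact (h l _ r e).1 rfl

/-- Trades the recursion on changing nets for conditions on the prefixes of one word, which can be
compared with chronicles of the original designs. -/
theorem interact_iff {S T : Set (List Action)} {p : List Action} :
    Interact S T p ↔ ∃ w, Runs S w ∧ Runs T (w.map Action.bar) ∧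
      (p = w ∧ [Action.daimon] ∈ residuals T (w.map Action.bar) ∨
        p = w ++ [.daimon] ∧ [Action.daimon] ∈ residuals S w) := by
  constructor
  · intro h
    induction h with
    | daimon_left h => exact ⟨[], runs_nil _, runs_nil _, .inr ⟨rfl, h⟩⟩
    | daimon_right h => exact ⟨[], runs_nil _, runs_nil _, .inl ⟨rfl, h⟩⟩
    | left h₁ h₂ _ ih =>
      obtain ⟨w, h₃, h₄, h₅⟩ := ih
      refine ⟨_ :: w, runs_cons.2 ⟨by simp, h₁, h₃⟩, runs_cons.2 ⟨by simp, h₂, h₄⟩, ?_⟩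
      rcases h₅ with ⟨rfl, h⟩ | ⟨rfl, h⟩
      exacts [.inl ⟨rfl, h⟩, .inr ⟨rfl, h⟩]
    | right h₁ h₂ _ ih =>
      obtain ⟨w, h₃, h₄, h₅⟩ := ih
      refine ⟨_ :: w, runs_cons.2 ⟨by simp, h₁, h₃⟩, runs_cons.2 ⟨by simp, h₂, h₄⟩, ?_⟩
      rcases h₅ with ⟨rfl, h⟩ | ⟨rfl, h⟩
      exacts [.inl ⟨rfl, h⟩, .inr ⟨rfl, h⟩]
  · rintro ⟨w, h₁, h₂, h₃⟩
    induction w generalizing S T p with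
    | nil =>
      rcases h₃ with ⟨rfl, h⟩ | ⟨rfl, h⟩
      exacts [.daimon_right h, .daimon_left h]
    | cons κ w ih =>
      obtain ⟨h₄, h₅, h₆⟩ := runs_cons.1 h₁
      obtain ⟨-, h₇, h₈⟩ := runs_cons.1 h₂
      cases κ with
      | daimon => exact absurd rfl h₄
      | proper ε σ I =>
        obtain ⟨q, rfl, hq⟩ : ∃ q, p = .proper ε σ I :: q ∧
            (q = w ∧ [Action.daimon] ∈ residuals (residual T (.proper ε.opp σ I))
              (w.map Action.bar) ∨
            q = w ++ [.daimon] ∧ [Action.daimon] ∈ residuals (residual S (.proper ε σ I)) w) := by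
          rcases h₃ with ⟨rfl, h⟩ | ⟨rfl, h⟩
          exacts [⟨_, rfl, .inl ⟨rfl, h⟩⟩, ⟨_, rfl, .inr ⟨rfl, h⟩⟩]
        have := ih h₆ h₈ hq
        cases ε with
        | plus => exact .left h₅ h₇ this
        | minus => exact .right h₅ h₇ this

theorem Interact.symm {S T : Set (List Action)} {p : List Action} (h : Interact S T p) :
    Interact T S (dual p) := by
  obtain ⟨w, h₁, h₂, h₃⟩ := interact_iff.1 h
  refine interact_iff.2 ⟨w.map Action.bar, h₂, by simpa using h₁, ?_⟩
  rcases h₃ with ⟨rfl, h₄⟩ | ⟨rfl, h₄⟩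
  · exact .inr ⟨dual_of_daimon_notMem h₁.proper, h₄⟩
  · exact .inl ⟨dual_append_daimon w, by simpa using h₄⟩

theorem residual_mono {R R' : Set (List Action)} (h : R ⊆ R') (κ : Action) :
    residual R κ ⊆ residual R' κ := by
  rintro c (⟨h₁, h₂⟩ | ⟨h₁, h₂⟩)
  exacts [.inl ⟨h₁, h h₂⟩, .inr ⟨h h₁, h₂⟩]

theorem Interact.mono {S S' T : Set (List Action)} {p : List Action} (h : Interact S T p)
    (hS : S ⊆ S') : Interact S' T p := by
  induction h generalizing S' with
  | daimon_left h => exact .daimon_left (hS h)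
  | daimon_right h => exact .daimon_right h
  | left h₁ h₂ _ ih => exact .left (hS h₁) h₂ (ih (residual_mono hS _))
  | right h₁ h₂ _ ih => exact .right (hS h₁) h₂ (ih (residual_mono hS _))

/-- Each visited action either shortens the chronicle by its head or leaves it intact; `u` collects
the removed heads. -/
theorem exists_sublist_of_mem_residuals {R : Set (List Action)} {l c : List Action}
    (h : c ∈ residuals R l) : ∃ u, u <+ l ∧ u ++ c ∈ R := by
  induction l generalizing R with
  | nil => exact ⟨[], by simp, h⟩
  | cons κ l ih =>
    obtain ⟨u, hu, huc⟩ := ih (R := residual R κ) h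
    rcases huc with ⟨-, h'⟩ | ⟨h', -⟩
    · exact ⟨κ :: u, hu.cons_cons κ, h'⟩
    · exact ⟨u, hu.cons κ, h'⟩

/-- Actions of `u` consume the chronicle; any other action of `l` differs in focus from the head of
what remains, by linearity, so `residual` does not erase it. -/
theorem mem_residuals {R : Set (List Action)} {l u : List Action} {κ : Action}
    (hl : Linear (l ++ [κ])) (hu : u <+ l) (h : u ++ [κ] ∈ R) : [κ] ∈ residuals R l := by
  induction l generalizing R u with
  | nil =>
    rw [List.sublist_nil] at hu
    subst hu
    exact h
  | cons a l ih =>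
    have hl' : Linear (l ++ [κ]) := hl.sublist (by simp)
    rw [residuals_cons]
    rcases hu with _ | hu | hu
    · rename_i hu
      refine ih hl' hu (.inr ⟨h, ?_⟩)
      intro κ' hκ' e
      have hm : κ' ∈ l ++ [κ] :=
        (hu.append (List.Sublist.refl [κ])).subset (List.mem_of_head? hκ')
      have := hl.eq_of_focus_eq (κ := κ') (κ' := a) (by simpa using .inr (by simpa using hm))
        (by simp) e
      subst this
      have hn := hl.nodup
      rw [List.cons_append, List.nodup_cons] at hn
      exact hn.1 hm
    · rename_i u hu
      exact ih hl' hu (.inl ⟨by simp, h⟩)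

/-! ### Paths visited in a design -/

/-- `p` is travelled in the design `D`: each of its actions ends a chronicle of `D` extracted from
the corresponding prefix of `p`. -/
def Travels (D : Set (List Action)) (p : List Action) : Prop :=
  ∀ l κ r, p = l ++ κ :: r → ∃ u, u <+ l ∧ u ++ [κ] ∈ D

theorem Travels.of_append {D : Set (List Action)} {l r : List Action} (h : Travels D (l ++ r)) :
    Travels D l := by
  rintro l₁ κ l₂ rfl
  exact h l₁ κ (l₂ ++ r) (by simp)

theorem Runs.travels {D : Set (List Action)} {w : List Action} (h : Runs D w) : Travels D w :=
  fun l κ r e => exists_sublist_of_mem_residuals (h l κ r e).2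

theorem Travels.runs {D : Set (List Action)} {w : List Action} (h : Travels D w) (hl : Linear w)
    (hd : Action.daimon ∉ w) : Runs D w := by
  rintro l κ r rfl
  obtain ⟨u, hu, huc⟩ := h l κ r rfl
  refine ⟨by rintro rfl; simp at hd, mem_residuals (hl.sublist ?_) hu huc⟩
  exact (List.Sublist.refl l).append (by simp)

theorem IsDesign.ne_daimon_of_append_cons {β : Base} {D : Set (List Action)} (hD : IsDesign β D)
    {u : List Action} {κ : Action} (h : u ++ [κ] ∈ D) : Action.daimon ∉ u := by
  simpa using (hD.chronicle _ h).isPath.daimon_last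

theorem IsDesign.justifies_of_minus {β : Base} {D : Set (List Action)} (hD : IsDesign β D)
    {u : List Action} {x κ : Action} (h : u ++ [x] ++ [κ] ∈ D) (hκ : κ.polarity = .minus) :
    Justifies x κ := by
  have hc := hD.chronicle _ h
  have hi : ¬ Initial β κ := fun hi => by
    have := hc.isPath.justified.eq_nil_of_initial hc.isPath.linear
      (hD.ne_daimon_of_append_cons h) hi
    simp at this
  obtain ⟨l', κ', e, hj⟩ := hc.infix_of_minus hκ hi
  obtain ⟨-, e⟩ := List.append_inj' e rfl
  simp only [List.cons.injEq, and_true] at e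
  rwa [e]

/-- Suppose `κ'` was visited earlier on the same focus. If the chronicle leading to `κ` contains
`κ'`, it repeats a focus. Otherwise it survived the visit of `κ'`, so the action before `κ` in it
was visited later; that action justifies `κ`, whereas the justifier of `κ'`, on the same focus, came
earlier. -/
theorem Runs.focus_notMem_of_minus {β : Base} {D : Set (List Action)} (hD : IsDesign β D)
    {w : List Action} {κ : Action} (hw : Runs D (w ++ [κ])) (hl : Linear w)
    (hκ : κ.polarity = .minus) : κ.focus ∉ w.map Action.focus := by
  intro hm
  obtain ⟨κ', hκ', hf⟩ := List.mem_map.1 hm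
  obtain ⟨w₁, w₂, rfl⟩ := List.mem_iff_append.1 hκ'
  have h₁ := (hw _ κ [] rfl).2
  rw [residuals_append, residuals_cons] at h₁
  obtain ⟨u, hu, h₂⟩ := exists_sublist_of_mem_residuals h₁
  rcases h₂ with ⟨-, h₂⟩ | ⟨h₂, h₃⟩
  · obtain ⟨v, -, h₄⟩ := exists_sublist_of_mem_residuals h₂
    have := (hD.chronicle _ h₄).isPath.linear
    have hs : [κ', κ] <+ v ++ κ' :: (u ++ [κ]) := by
      have : [κ] <+ u ++ [κ] := List.sublist_append_right _ _
      exact (this.cons_cons κ').trans (List.sublist_append_right _ _)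
    have := this.sublist hs
    simp [Linear, hf] at this
  · obtain ⟨v, -, h₄⟩ := exists_sublist_of_mem_residuals h₂
    rcases eq_nil_or_append_singleton u with rfl | ⟨u, x, rfl⟩
    · exact h₃ κ (by simp) hf.symm
    · have h₄' : (v ++ u) ++ [x] ++ [κ] ∈ D := by simpa using h₄
      have hj := hD.justifies_of_minus h₄' hκ
      have hx : x ∈ w₂ := hu.subset (by simp)
      have hr := hw w₁ κ' (w₂ ++ [κ]) (by simp)
      obtain ⟨v', hv', h₅⟩ := exists_sublist_of_mem_residuals hr.2
      rcases (hD.chronicle _ h₅).isPath.justified v' κ' [] rfl hr.1 with hi | ⟨y, hy, hyj⟩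
      · exact (hD.chronicle _ h₄').isPath.justified.focus_ne (γ := x) (by simp) hj
          (hf.symm.trans hi.1)
      · have e : y = x := hl.eq_of_focus_eq (by simp [hv'.subset hy]) (by simp [hx])
          (hyj.focus_eq hj hf)
        subst e
        have hn := hl.nodup
        rw [List.nodup_append] at hn
        exact hn.2.2 _ (hv'.subset hy) y (by simp [hx]) rfl

theorem IsDesign.coherent_plus {β : Base} {D : Set (List Action)} (hD : IsDesign β D)
    {u : List Action} {κ κ' : Action} (h : u ++ [κ] ∈ D) (h' : u ++ [κ'] ∈ D)
    (hκ : κ.polarity = .plus) : κ = κ' := by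
  rcases (hD.clique _ h _ h').comparability u κ κ' (List.prefix_refl _) (List.prefix_refl _) with
    h | h
  · exact h
  · rw [hκ] at h
    cases h.1

theorem IsDesign.polarity_of_append_pair {β : Base} {D : Set (List Action)} (hD : IsDesign β D)
    {u : List Action} {x κ : Action} (h : u ++ [x] ++ [κ] ∈ D) : x.polarity ≠ κ.polarity := by
  have := (hD.chronicle _ h).isPath.alternation
  rw [List.isChain_append] at this
  simpa using this.2.2

theorem IsDesign.polarity_of_singleton {β : Base} {D : Set (List Action)} (hD : IsDesign β D)
    {κ : Action} (h : [κ] ∈ D) : κ.polarity = β.polarity := by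
  have hc := (hD.chronicle _ h).isPath
  by_cases hκ : κ = .daimon
  · subst hκ
    rw [hc.daimon_first rfl]
    rfl
  · rcases hc.justified [] κ [] rfl hκ with h | ⟨_, h, -⟩
    · exact h.2
    · simp at h

/-- The chronicle extracted from `w` that carries a given action is unique; for a positive action it
extends the last action of `w`. -/
theorem IsDesign.view_unique {β : Base} {D : Set (List Action)} (hD : IsDesign β D)
    {w : List Action} (ht : Travels D w) (hl : Linear w) (hd : Action.daimon ∉ w)
    (ha : w.IsChain (fun κ κ' => κ.polarity ≠ κ'.polarity)) :
    (∀ u κ, u <+ w → u ++ [κ] ∈ D → κ.polarity = .plus → κ ∉ w →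
      u = [] ∧ w = [] ∨ ∃ u' w' x, u = u' ++ [x] ∧ w = w' ++ [x] ∧ x.polarity = .minus) ∧
    (∀ u u' κ, u <+ w → u' <+ w → u ++ [κ] ∈ D → u' ++ [κ] ∈ D → κ ∉ w → u = u') := by
  induction hn : w.length using Nat.strong_induction_on generalizing w with
  | _ n ih =>
    have ihl : ∀ l r, w = l ++ r → r ≠ [] → _ := fun l r e hr => ih l.length
      (by rw [← hn, e, List.length_append]; have := List.length_pos_iff.2 hr; omega)
      (w := l) (by rw [e] at ht; exact ht.of_append)
      (by rw [e] at hl; exact hl.sublist (List.sublist_append_left _ _))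
      (by rw [e] at hd; exact fun h => hd (by simp [h]))
      (by rw [e] at ha; exact ha.prefix (List.prefix_append _ _)) rfl
    have notMem : ∀ l x r, w = l ++ x :: r → x ∉ l ∧ x ∉ r := by
      rintro l x r rfl
      have := hl.nodup
      rw [List.nodup_append, List.nodup_cons] at this
      exact ⟨fun h => this.2.2 x h x (by simp) rfl, this.2.1.1⟩
    -- If the last action `x` of `u` had a successor `y` in `w`, then `y` would be positive and, by
    -- induction, reached through the same chronicle ending in `x`. Coherence would give `κ = y`,
    -- already in `w`.
    have pos : ∀ u κ, u <+ w → u ++ [κ] ∈ D → κ.polarity = .plus → κ ∉ w →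
        u = [] ∧ w = [] ∨ ∃ u' w' x, u = u' ++ [x] ∧ w = w' ++ [x] ∧ x.polarity = .minus := by
      intro u κ hu huκ hp hκ
      rcases eq_nil_or_append_singleton u with rfl | ⟨u, x, rfl⟩
      · left
        refine ⟨rfl, ?_⟩
        cases w with
        | nil => rfl
        | cons y w =>
          obtain ⟨v, hv, hvy⟩ := ht [] y w rfl
          rw [List.sublist_nil] at hv
          subst hv
          have := hD.coherent_plus huκ hvy hp
          simp [this] at hκ
      · right
        have hx : x.polarity = .minus := by
          have := hD.polarity_of_append_pair huκ
          rw [hp] at this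
          simpa using this
        obtain ⟨w₁, w₂, e⟩ := List.mem_iff_append.1 (hu.subset (by simp : x ∈ u ++ [x]))
        have hu₁ : u <+ w₁ :=
          sublist_of_append_singleton_sublist (notMem _ _ _ e).2 (by rw [← e]; exact hu)
        cases w₂ with
        | nil => exact ⟨u, w₁, x, rfl, e, hx⟩
        | cons y w₂ =>
          exfalso
          have e' : w = (w₁ ++ [x]) ++ y :: w₂ := by simpa using e
          obtain ⟨v, hv, hvy⟩ := ht (w₁ ++ [x]) y w₂ e'
          have hy : y.polarity = .plus := by
            rw [e, List.isChain_append, List.isChain_cons_cons] at ha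
            have := ha.2.1.1
            rw [hx, Polarity.ne_iff] at this
            exact this
          rcases (ihl _ _ e' (by simp)).1 v y hv hvy hy (notMem _ _ _ e').1 with
            ⟨-, h⟩ | ⟨v', w', x', rfl, h, -⟩
          · simp at h
          · obtain ⟨-, h₀⟩ := List.append_inj' h rfl
            simp only [List.cons.injEq, and_true] at h₀
            subst h₀
            have hv₁ : v' <+ w₁ := sublist_of_append_singleton_sublist (r := []) (by simp) hv
            have h₁ : u ++ [x] ∈ D := hD.prefix_closed _ huκ _ (List.prefix_append _ _) (by simp)
            have h₂ : v' ++ [x] ∈ D := hD.prefix_closed _ hvy _ (List.prefix_append _ _) (by simp)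
            have := (ihl _ _ e (by simp)).2 u v' x hu₁ hv₁ h₁ h₂ (notMem _ _ _ e).1
            subst this
            have := hD.coherent_plus huκ hvy hp
            subst this
            exact hκ (by rw [e]; simp)
    refine ⟨pos, ?_⟩
    have step : ∀ u u' x κ, u ++ [x] <+ w → u' ++ [x] <+ w → u ++ [x] ++ [κ] ∈ D →
        u' ++ [x] ++ [κ] ∈ D → u = u' := by
      intro u u' x κ hu hu' h h'
      obtain ⟨w₁, w₂, e⟩ := List.mem_iff_append.1 (hu.subset (by simp : x ∈ u ++ [x]))
      have hr := (notMem _ _ _ e).2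
      refine (ihl _ _ e (by simp)).2 u u' x
        (sublist_of_append_singleton_sublist hr (by rw [← e]; exact hu))
        (sublist_of_append_singleton_sublist hr (by rw [← e]; exact hu')) ?_ ?_ (notMem _ _ _ e).1
      · exact hD.prefix_closed _ h _ (List.prefix_append _ _) (by simp)
      · exact hD.prefix_closed _ h' _ (List.prefix_append _ _) (by simp)
    intro u u' κ hu hu' h h' hκ
    by_cases hp : κ.polarity = .plus
    · rcases pos u κ hu h hp hκ with ⟨rfl, rfl⟩ | ⟨u, w', x, rfl, rfl, -⟩
      · rw [List.sublist_nil] at hu'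
        exact hu'.symm
      · rcases pos u' κ hu' h' hp hκ with ⟨-, h₀⟩ | ⟨u', w'', x', rfl, e, -⟩
        · simp at h₀
        · obtain ⟨-, e⟩ := List.append_inj' e rfl
          simp only [List.cons.injEq, and_true] at e
          subst e
          rw [step u u' x κ hu hu' h h']
    -- For a negative action the preceding action of the chronicle is its justifier, which linearity
    -- determines.
    · have hp : κ.polarity = .minus := by simpa using hp
      have mixed : ∀ {v x}, [κ] ∈ D → v ++ [x] ++ [κ] ∈ D → False := by
        intro v x h₁ h₂
        have hi : Initial β κ := by
          simpa using (hD.chronicle _ h₁).isPath.justified [] κ [] rfl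
            (Action.ne_daimon_of_minus hp)
        exact (hD.chronicle _ h₂).isPath.justified.not_initial (γ := x) (by simp)
          (hD.justifies_of_minus h₂ hp) hi
      rcases eq_nil_or_append_singleton u with rfl | ⟨u, x, rfl⟩
      · rcases eq_nil_or_append_singleton u' with rfl | ⟨u', x', rfl⟩
        · rfl
        · exact (mixed h h').elim
      · rcases eq_nil_or_append_singleton u' with rfl | ⟨u', x', rfl⟩
        · exact (mixed h' h).elim
        · have e : x = x' := hl.eq_of_focus_eq (hu.subset (by simp)) (hu'.subset (by simp))
            ((hD.justifies_of_minus h hp).focus_eq (hD.justifies_of_minus h' hp) rfl)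
          subst e
          rw [step u u' x κ hu hu' h h']

/-! ### Structure of the visited paths -/

/-- Properties of the sequences that are visited in `D` by an interaction. -/
structure VisitedPath (β : Base) (D : Set (List Action)) (p : List Action) : Prop where
  travels : Travels D p
  linear : Linear p
  alternation : p.IsChain (fun κ κ' => κ.polarity ≠ κ'.polarity)
  eq_close : p = close β (core p)

theorem IsDesign.turn_of_plus {β : Base} {D : Set (List Action)} (hD : IsDesign β D)
    {w : List Action} (ht : Travels D w) (hl : Linear w) (hd : Action.daimon ∉ w)
    (ha : w.IsChain (fun κ κ' => κ.polarity ≠ κ'.polarity)) {u : List Action} {κ : Action}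
    (hu : u <+ w) (h : u ++ [κ] ∈ D) (hp : κ.polarity = .plus) (hκ : κ ∉ w) :
    turn β w = .plus := by
  rcases (hD.view_unique ht hl hd ha).1 u κ hu h hp hκ with ⟨rfl, rfl⟩ | ⟨u, w, x, rfl, rfl, hx⟩
  · rw [turn_nil, ← hD.polarity_of_singleton h, hp]
  · rw [turn_append_singleton, hx]
    rfl

theorem isChain_append_of_turn {β : Base} {w : List Action} {κ : Action}
    (ha : w.IsChain (fun κ κ' => κ.polarity ≠ κ'.polarity)) (h : turn β w = κ.polarity) :
    (w ++ [κ]).IsChain (fun κ κ' => κ.polarity ≠ κ'.polarity) := by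
  rw [List.isChain_append]
  refine ⟨ha, by simp, ?_⟩
  rcases eq_nil_or_append_singleton w with rfl | ⟨w, x, rfl⟩
  · simp
  · simp only [List.getLast?_append, List.getLast?_singleton, Option.some_or, Option.mem_def,
      Option.some.injEq, List.head?_cons, forall_eq']
    rw [turn_append_singleton] at h
    rw [Polarity.ne_iff, h]

theorem linear_append_daimon {w : List Action} (hl : Linear w) (hd : Action.daimon ∉ w) :
    Linear (w ++ [.daimon]) := by
  rw [linear_append_singleton]
  refine ⟨hl, fun hm => ?_⟩
  obtain ⟨a, ha, hf⟩ := List.mem_map.1 hm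
  rw [Action.daimon_focus, Action.focus_eq_none] at hf
  exact hd (hf ▸ ha)

/-- Each action is negative for one design and positive for the other. The first design guarantees a
fresh focus, the second that it is its turn. -/
theorem Runs.linear_and_alternation {β : Base} {D E : Set (List Action)} (hD : IsDesign β D)
    (hE : IsDesign β.dual E) {w : List Action} (h : Runs D w) (h' : Runs E (w.map Action.bar)) :
    Linear w ∧ w.IsChain (fun κ κ' => κ.polarity ≠ κ'.polarity) := by
  induction w using List.reverseRecOn with
  | nil => exact ⟨by simp [Linear], by simp⟩
  | append_singleton w κ ih =>
    have h'' : Runs E (w.map Action.bar ++ [κ.bar]) := by simpa using h'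
    obtain ⟨hl, ha⟩ := ih h.of_append h''.of_append
    have hκ : κ ≠ .daimon := (h w κ [] rfl).1
    have hd := h.of_append.proper
    have hf : κ.focus ∉ w.map Action.focus := by
      by_cases hp : κ.polarity = .minus
      · exact Runs.focus_notMem_of_minus hD h hl hp
      · have := Runs.focus_notMem_of_minus hE h'' (linear_map_bar.2 hl)
          (by rw [Action.bar_polarity hκ]; simpa using hp)
        simpa using this
    have hm : κ ∉ w := fun hm => hf (List.mem_map_of_mem hm)
    refine ⟨linear_append_singleton.2 ⟨hl, hf⟩, isChain_append_of_turn (β := β) ha ?_⟩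
    by_cases hp : κ.polarity = .plus
    · obtain ⟨u, hu, huκ⟩ := exists_sublist_of_mem_residuals (h w κ [] rfl).2
      rw [hp]
      exact hD.turn_of_plus h.of_append.travels hl hd ha hu huκ hp hm
    · have hp : κ.polarity = .minus := by simpa using hp
      obtain ⟨u, hu, huκ⟩ := exists_sublist_of_mem_residuals (h'' _ κ.bar [] rfl).2
      have := hE.turn_of_plus h''.of_append.travels (linear_map_bar.2 hl) (by simpa using hd)
        (isChain_polarity_map_bar hd ha) hu huκ (by rw [Action.bar_polarity hκ, hp]; rfl)
        (by
          rw [List.mem_map]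
          rintro ⟨a, ha, e⟩
          exact hm (Action.bar_injective e ▸ ha))
      rw [turn_dual_map_bar hd, Polarity.opp_eq_plus] at this
      rw [this, hp]

theorem Interact.visitedPath {β : Base} {D E : Set (List Action)} (hD : IsDesign β D)
    (hE : IsDesign β.dual E) {p : List Action} (h : Interact D E p) : VisitedPath β D p := by
  obtain ⟨w, h₁, h₂, h₃⟩ := interact_iff.1 h
  obtain ⟨hl, ha⟩ := Runs.linear_and_alternation hD hE h₁ h₂
  have hd := h₁.proper
  rcases h₃ with ⟨rfl, h₃⟩ | ⟨rfl, h₃⟩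
  · refine ⟨h₁.travels, hl, ha, ?_⟩
    obtain ⟨u, hu, huκ⟩ := exists_sublist_of_mem_residuals h₃
    have := hE.turn_of_plus h₂.travels (linear_map_bar.2 hl) (by simpa using hd)
      (isChain_polarity_map_bar hd ha) hu huκ rfl (by simpa using hd)
    rw [turn_dual_map_bar hd, Polarity.opp_eq_plus] at this
    rw [core_eq_self hd, close_of_minus this]
  · obtain ⟨u, hu, huκ⟩ := exists_sublist_of_mem_residuals h₃
    have ht := hD.turn_of_plus h₁.travels hl hd ha hu huκ rfl hd
    refine ⟨?_, linear_append_daimon hl hd, isChain_append_of_turn (β := β) ha ht, ?_⟩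
    · intro l κ r e
      rcases eq_nil_or_append_singleton r with rfl | ⟨r, b, rfl⟩
      · obtain ⟨rfl, e₁⟩ := List.append_inj' e rfl
        simp only [List.cons.injEq, and_true] at e₁
        subst e₁
        exact ⟨u, hu, huκ⟩
      · have e' : w ++ [.daimon] = (l ++ κ :: r) ++ [b] := by simpa using e
        obtain ⟨rfl, -⟩ := List.append_inj' e' rfl
        exact h₁.travels l κ r rfl
    · rw [core_append, core_daimon, List.append_nil, core_eq_self hd, close_of_plus ht]

/-- The only chronicles of `D` that matter to this interaction are those extracted from `p`, so any
set containing suitable ones can replace `D`. -/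
theorem Interact.of_travels {β : Base} {D D' E : Set (List Action)} (hD : IsDesign β D)
    (hE : IsDesign β.dual E) {p : List Action} (h : Interact D E p) (ht : Travels D' p) :
    Interact D' E p := by
  have hv := h.visitedPath hD hE
  obtain ⟨w, h₁, h₂, h₃⟩ := interact_iff.1 h
  rcases h₃ with ⟨rfl, h₃⟩ | ⟨rfl, h₃⟩
  · exact interact_iff.2 ⟨p, ht.runs hv.linear h₁.proper, h₂, .inl ⟨rfl, h₃⟩⟩
  · refine interact_iff.2 ⟨w, ht.of_append.runs (hv.linear.sublist (List.sublist_append_left _ _))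
      h₁.proper, h₂, .inr ⟨rfl, ?_⟩⟩
    obtain ⟨u, hu, huκ⟩ := ht w .daimon [] rfl
    exact mem_residuals hv.linear hu huκ

namespace VisitedPath

variable {β : Base} {D : Set (List Action)} {l r : List Action} {κ : Action}

theorem daimon_notMem (h : VisitedPath β D (l ++ κ :: r)) : Action.daimon ∉ l := by
  have : Action.daimon ∉ (l ++ κ :: r).dropLast := by
    rw [h.eq_close]
    rcases turn_cases β (core (l ++ κ :: r)) with ht | ht
    · rw [close_of_plus ht, List.dropLast_concat]
      exact daimon_notMem_core _
    · rw [close_of_minus ht]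
      exact fun h => daimon_notMem_core _ (List.mem_of_mem_dropLast h)
  rw [List.dropLast_append_of_ne_nil (by simp)] at this
  exact fun h => this (by simp [h])

theorem notMem (h : VisitedPath β D (l ++ κ :: r)) : κ ∉ l := by
  have := h.linear.nodup
  rw [List.nodup_append] at this
  exact fun hm => this.2.2 κ hm κ (by simp) rfl

theorem last_of_plus (hD : IsDesign β D) (h : VisitedPath β D (l ++ κ :: r)) {u : List Action}
    (hu : u <+ l) (huκ : u ++ [κ] ∈ D) (hp : κ.polarity = .plus) :
    u = [] ∧ l = [] ∨ ∃ u' l' x, u = u' ++ [x] ∧ l = l' ++ [x] ∧ x.polarity = .minus :=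
  (hD.view_unique h.travels.of_append (h.linear.sublist (List.sublist_append_left _ _))
    h.daimon_notMem (h.alternation.prefix (List.prefix_append _ _))).1 u κ hu huκ hp h.notMem

theorem view_unique (hD : IsDesign β D) (h : VisitedPath β D (l ++ κ :: r)) {u u' : List Action}
    (hu : u <+ l) (hu' : u' <+ l) (huκ : u ++ [κ] ∈ D) (huκ' : u' ++ [κ] ∈ D) : u = u' :=
  (hD.view_unique h.travels.of_append (h.linear.sublist (List.sublist_append_left _ _))
    h.daimon_notMem (h.alternation.prefix (List.prefix_append _ _))).2 u u' κ hu hu' huκ huκ'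
      h.notMem

theorem next_eq (hD : IsDesign β D) (h : VisitedPath β D (l ++ κ :: r)) {κ' : Action}
    {r' : List Action} (h' : VisitedPath β D (l ++ κ' :: r')) (hp : κ.polarity = .plus) :
    κ = κ' := by
  obtain ⟨u, hu, huκ⟩ := h.travels l κ r rfl
  obtain ⟨v, hv, hvκ⟩ := h'.travels l κ' r' rfl
  rcases h.last_of_plus hD hu huκ hp with ⟨rfl, rfl⟩ | ⟨u, l, x, rfl, rfl, hx⟩
  · rw [List.sublist_nil] at hv
    subst hv
    exact hD.coherent_plus huκ hvκ hp
  · have hp' : κ'.polarity = .plus := by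
      have := h'.alternation
      rw [List.isChain_append] at this
      have := this.2.2 x (by simp) κ' (by simp)
      rw [hx, Polarity.ne_iff] at this
      exact this
    rcases h'.last_of_plus hD hv hvκ hp' with ⟨-, h₀⟩ | ⟨v, l', x', rfl, e, -⟩
    · simp at h₀
    · obtain ⟨-, e₁⟩ := List.append_inj' e rfl
      simp only [List.cons.injEq, and_true] at e₁
      subst e₁
      have hx : VisitedPath β D (l ++ x :: κ :: r) := by simpa using h
      have : u = v := hx.view_unique hD
        (sublist_of_append_singleton_sublist (r := []) (by simp) hu)
        (sublist_of_append_singleton_sublist (r := []) (by simp) hv)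
        (hD.prefix_closed _ huκ _ (List.prefix_append _ _) (by simp))
        (hD.prefix_closed _ hvκ _ (List.prefix_append _ _) (by simp))
      subst this
      exact hD.coherent_plus huκ hvκ hp

theorem eq_append (h : VisitedPath β D l) : ∃ s, l = core l ++ s := by
  rcases turn_cases β (core l) with ht | ht
  · have := h.eq_close
    rw [close_of_plus ht] at this
    exact ⟨_, this⟩
  · have := h.eq_close
    rw [close_of_minus ht] at this
    exact ⟨[], by simpa using this⟩

end VisitedPath

/-! ### Determinism of the interaction. -/

theorem prefix_or_prefix_or_split {α : Type*} (p q : List α) :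
    p = q ∨ (∃ a r, q = p ++ a :: r) ∨ (∃ a r, p = q ++ a :: r) ∨
      ∃ l a r b s, a ≠ b ∧ p = l ++ a :: r ∧ q = l ++ b :: s := by
  induction p generalizing q with
  | nil =>
    cases q with
    | nil => exact .inl rfl
    | cons b q => exact .inr (.inl ⟨b, q, rfl⟩)
  | cons a p ih =>
    cases q with
    | nil => exact .inr (.inr (.inl ⟨a, p, rfl⟩))
    | cons b q =>
      by_cases e : a = b
      · subst e
        rcases ih q with rfl | ⟨b, r, rfl⟩ | ⟨b, r, rfl⟩ | ⟨l, b, r, c, s, h, rfl, rfl⟩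
        · exact .inl rfl
        · exact .inr (.inl ⟨b, r, rfl⟩)
        · exact .inr (.inr (.inl ⟨b, r, rfl⟩))
        · exact .inr (.inr (.inr ⟨a :: l, b, r, c, s, h, rfl, rfl⟩))
      · exact .inr (.inr (.inr ⟨[], a, p, b, q, e, rfl, rfl⟩))

/-- At the first divergence the next action is positive for `D` or for `E`, and that design has only
one choice. If one play extends the other, the daimon ending the shorter interaction competes in the
same way with a proper action. -/
theorem Interact.unique {β : Base} {D E : Set (List Action)} (hD : IsDesign β D)
    (hE : IsDesign β.dual E) {p q : List Action} (hp : Interact D E p) (hq : Interact D E q) :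
    p = q := by
  have prefix_case : ∀ {p q : List Action}, Interact D E p → Interact D E q →
      ∀ a r, core q ≠ core p ++ a :: r := by
    intro p q hp hq a r e
    have vp := hp.visitedPath hD hE
    have vq := hq.visitedPath hD hE
    have hd := daimon_notMem_core p
    have ha : a ≠ .daimon := by
      rintro rfl
      exact daimon_notMem_core q (by rw [e]; simp)
    rcases turn_cases β (core p) with ht | ht
    · have ep := vp.eq_close
      rw [close_of_plus ht] at ep
      obtain ⟨s, eq⟩ := vq.eq_append
      rw [ep] at vp
      rw [eq, e, List.append_assoc, List.cons_append] at vq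
      exact ha (vp.next_eq hD vq rfl).symm
    · have vp' := hp.symm.visitedPath hE (by simpa using hD)
      have vq' := hq.symm.visitedPath hE (by simpa using hD)
      have ep := vp'.eq_close
      rw [core_dual, close_of_plus (by rw [turn_dual_map_bar hd, ht]; rfl)] at ep
      obtain ⟨s, eq⟩ := vq'.eq_append
      rw [ep] at vp'
      rw [eq, core_dual, e, List.map_append, List.map_cons, List.append_assoc,
        List.cons_append] at vq'
      exact ha (Action.bar_eq_daimon.1 (vp'.next_eq hE vq' rfl).symm)
  have vp := hp.visitedPath hD hE
  have vq := hq.visitedPath hD hE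
  rw [vp.eq_close, vq.eq_close]
  rcases prefix_or_prefix_or_split (core p) (core q) with
    e | ⟨a, r, e⟩ | ⟨a, r, e⟩ | ⟨l, a, r, b, s, hab, e₁, e₂⟩
  · rw [e]
  · exact absurd e (prefix_case hp hq a r)
  · exact absurd e (prefix_case hq hp a r)
  · exfalso
    by_cases ha : a.polarity = .plus
    · obtain ⟨s₁, e₃⟩ := vp.eq_append
      obtain ⟨s₂, e₄⟩ := vq.eq_append
      rw [e₃, e₁, List.append_assoc, List.cons_append] at vp
      rw [e₄, e₂, List.append_assoc, List.cons_append] at vq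
      exact hab (vp.next_eq hD vq ha)
    · have ha : a.polarity = .minus := by simpa using ha
      have vp' := hp.symm.visitedPath hE (by simpa using hD)
      have vq' := hq.symm.visitedPath hE (by simpa using hD)
      obtain ⟨s₁, e₃⟩ := vp'.eq_append
      obtain ⟨s₂, e₄⟩ := vq'.eq_append
      rw [e₃, core_dual, e₁, List.map_append, List.map_cons, List.append_assoc,
        List.cons_append] at vp'
      rw [e₄, core_dual, e₂, List.map_append, List.map_cons, List.append_assoc,
        List.cons_append] at vq'
      refine hab (Action.bar_injective (vp'.next_eq hE vq' ?_))
      rw [Action.bar_polarity (Action.ne_daimon_of_minus ha), ha]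
      rfl

/-! ### Dual pairs of behaviours, material designs -/

/-- `A` and `B` are the orthogonal of each other. -/
structure DualPair (β : Base) (A B : Set (Set (List Action))) : Prop where
  mem_left : ∀ D, D ∈ A ↔ IsDesign β D ∧ ∀ E ∈ B, Orthogonal D E
  mem_right : ∀ E, E ∈ B ↔ IsDesign β.dual E ∧ ∀ D ∈ A, Orthogonal D E

theorem orthogonal_comm {D E : Set (List Action)} : Orthogonal D E ↔ Orthogonal E D :=
  ⟨fun ⟨_, h⟩ => ⟨_, h.symm⟩, fun ⟨_, h⟩ => ⟨_, h.symm⟩⟩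

theorem DualPair.symm {β : Base} {A B : Set (Set (List Action))} (h : DualPair β A B) :
    DualPair β.dual B A where
  mem_left E := by simpa only [orthogonal_comm (D := E)] using h.mem_right E
  mem_right D := by simpa only [Base.dual_dual, orthogonal_comm (E := D)] using h.mem_left D

theorem IsBehaviour.dualPair {β : Base} {A : Set (Set (List Action))} (h : IsBehaviour β A) :
    DualPair β A (orth β A) where
  mem_left D := by
    conv_lhs => rw [h.2]
    simp only [orth, Set.mem_ofPred_eq, Base.dual_dual, orthogonal_comm (E := D)]
  mem_right E := Iff.rfl

/-- The part of `D` that is visited by the interactions with the elements of `B`. -/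
def visitedPart (B : Set (Set (List Action))) (D : Set (List Action)) : Set (List Action) :=
  {c | c ∈ D ∧ ∃ E ∈ B, ∃ l κ r u, Interact D E (l ++ κ :: r) ∧ u <+ l ∧ c = u ++ [κ]}

namespace DualPair

variable {β : Base} {A B : Set (Set (List Action))}

theorem isDesign_left (h : DualPair β A B) {D : Set (List Action)} (hD : D ∈ A) : IsDesign β D :=
  ((h.mem_left D).1 hD).1

theorem isDesign_right (h : DualPair β A B) {E : Set (List Action)} (hE : E ∈ B) :
    IsDesign β.dual E := ((h.mem_right E).1 hE).1

theorem orthogonal (h : DualPair β A B) {D E : Set (List Action)} (hD : D ∈ A) (hE : E ∈ B) :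
    Orthogonal D E := ((h.mem_left D).1 hD).2 E hE

theorem visitedPath (h : DualPair β A B) {D E : Set (List Action)} (hD : D ∈ A) (hE : E ∈ B)
    {p : List Action} (hp : Interact D E p) : VisitedPath β D p :=
  hp.visitedPath (h.isDesign_left hD) (h.isDesign_right hE)

theorem travels_visitedPart (h : DualPair β A B) {D E : Set (List Action)} (hD : D ∈ A)
    (hE : E ∈ B) {p : List Action} (hp : Interact D E p) : Travels (visitedPart B D) p := by
  rintro l κ r rfl
  obtain ⟨u, hu, huκ⟩ := (h.visitedPath hD hE hp).travels l κ r rfl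
  exact ⟨u, hu, huκ, E, hE, l, κ, r, u, hp, hu, rfl⟩

theorem interact_visitedPart (h : DualPair β A B) {D E : Set (List Action)} (hD : D ∈ A)
    (hE : E ∈ B) {p : List Action} (hp : Interact D E p) : Interact (visitedPart B D) E p :=
  hp.of_travels (h.isDesign_left hD) (h.isDesign_right hE) (h.travels_visitedPart hD hE hp)

theorem isDesign_visitedPart (h : DualPair β A B) (hB : B.Nonempty) {D : Set (List Action)}
    (hD : D ∈ A) : IsDesign β (visitedPart B D) := by
  have hDd := h.isDesign_left hD
  refine ⟨fun c hc => hDd.chronicle c hc.1, fun c hc d hd => hDd.clique c hc.1 d hd.1, ?_, ?_, ?_⟩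
  · rintro c ⟨hc, E, hE, l, κ, r, u, hp, hu, rfl⟩ c' hc' hne
    refine ⟨hDd.prefix_closed _ hc c' hc' hne, E, hE, ?_⟩
    rcases List.prefix_concat_iff.1 hc' with rfl | hc'
    · exact ⟨l, κ, r, u, hp, hu, rfl⟩
    · rcases eq_nil_or_append_singleton c' with rfl | ⟨u', κ', rfl⟩
      · exact absurd rfl hne
      · obtain ⟨l₁, l₂, rfl, hu'⟩ :=
          exists_prefix_of_append_singleton_sublist (hc'.sublist.trans hu)
        exact ⟨l₁, κ', l₂ ++ κ :: r, u', by simpa using hp, hu', rfl⟩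
  · rintro c ⟨hc, E, hE, l, κ, r, u, hp, hu, rfl⟩ hmax κ' hκ'
    simp only [List.getLast?_append, List.getLast?_singleton, Option.some_or, Option.mem_def,
      Option.some.injEq] at hκ'
    subst hκ'
    by_contra hn
    have hκ : κ.polarity = .minus := by simpa using hn
    have hv := h.visitedPath hD hE hp
    cases r with
    -- A negative action cannot end the visited path. When a positive `y` follows it, the chronicle
    -- of `y` extends that of `κ`, which contradicts maximality.
    | nil =>
      have := positiveEnded_close β (core (l ++ [κ]))
      rw [← hv.eq_close] at this
      exact hn (this κ (by simp))
    | cons y r =>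
      have hp' : Interact D E ((l ++ [κ]) ++ y :: r) := by simpa using hp
      have hv' := h.visitedPath hD hE hp'
      have hy : y.polarity = .plus := by
        have := hv.alternation
        rw [List.isChain_append, List.isChain_cons_cons] at this
        have := this.2.1.1
        rw [hκ, Polarity.ne_iff] at this
        exact this
      obtain ⟨v, hv₁, hvy⟩ := hv'.travels _ y r rfl
      rcases hv'.last_of_plus hDd hv₁ hvy hy with ⟨-, h₀⟩ | ⟨v, l', x, rfl, e, -⟩
      · simp at h₀
      · obtain ⟨-, e₁⟩ := List.append_inj' e rfl
        simp only [List.cons.injEq, and_true] at e₁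
        subst e₁
        have : u = v := hv.view_unique hDd hu
          (sublist_of_append_singleton_sublist (r := []) (by simp) hv₁) hc
          (hDd.prefix_closed _ hvy _ (List.prefix_append _ _) (by simp))
        subst this
        have hm : u ++ [κ] ++ [y] ∈ visitedPart B D :=
          ⟨hvy, E, hE, l ++ [κ], y, r, u ++ [κ], hp', hv₁, rfl⟩
        have := hmax _ hm (List.prefix_append _ _)
        simp at this
  · intro hβ
    obtain ⟨E, hE⟩ := hB
    obtain ⟨p, hp⟩ := h.orthogonal hD hE
    have ht := h.travels_visitedPart hD hE hp
    cases p with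
    | nil =>
      have := (h.visitedPath hD hE hp).eq_close
      rw [close_of_plus (by simpa [core] using hβ)] at this
      simp at this
    | cons κ r =>
      obtain ⟨u, -, hu⟩ := ht [] κ r rfl
      exact ⟨_, hu⟩

theorem visitedPart_mem (h : DualPair β A B) (hB : B.Nonempty) {D : Set (List Action)}
    (hD : D ∈ A) : visitedPart B D ∈ A := by
  refine (h.mem_left _).2 ⟨h.isDesign_visitedPart hB hD, fun E hE => ?_⟩
  obtain ⟨p, hp⟩ := h.orthogonal hD hE
  exact ⟨p, h.interact_visitedPart hD hE hp⟩

/-- A smaller `F` in `A` must follow, against each `E`, the same path as `D` by determinism, and so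
contains the chronicles extracted from it. -/
theorem material_visitedPart (h : DualPair β A B) (hB : B.Nonempty) {D : Set (List Action)}
    (hD : D ∈ A) : Material A (visitedPart B D) := by
  refine ⟨h.visitedPart_mem hB hD, ?_⟩
  rintro F hF hFD c ⟨hc, E, hE, l, κ, r, u, hp, hu, rfl⟩
  have hDd := h.isDesign_left hD
  obtain ⟨q, hq⟩ := h.orthogonal hF hE
  have hFD' : F ⊆ D := fun c hc => (hFD hc).1
  have e := Interact.unique hDd (h.isDesign_right hE) hp (hq.mono hFD')
  subst e
  obtain ⟨v, hv, hvκ⟩ := (h.visitedPath hF hE hq).travels l κ r rfl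
  rwa [(h.visitedPath hD hE hp).view_unique hDd hu hv hc (hFD' hvκ)]

theorem visitedPart_eq (h : DualPair β A B) (hB : B.Nonempty) {D : Set (List Action)}
    (hD : Material A D) : D ⊆ visitedPart B D :=
  hD.2 (h.visitedPart_mem hB hD.1) fun _ hc => hc.1

end DualPair

/-! ### Daimon designs -/

/-- With `negativeDaimon`, this shows that a behaviour and its orthogonal are non-empty, and it
settles the empty play in the final induction. -/
theorem isDesign_daimon {β : Base} (hβ : β.polarity = .plus) :
    IsDesign β {[Action.daimon]} := by
  have hpath := (play_nil β).isPath_close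
  rw [close_of_plus (by simpa using hβ)] at hpath
  refine ⟨?_, ?_, ?_, ?_, fun _ => ⟨_, rfl⟩⟩
  · rintro c rfl
    refine ⟨hpath, by simp, fun w κ h hκ _ => ?_⟩
    have := h.subset (by simp : κ ∈ w ++ [κ])
    simp only [List.mem_singleton] at this
    exact absurd this (Action.ne_daimon_of_minus hκ)
  · rintro c rfl d rfl
    refine ⟨fun w κ₁ κ₂ h₁ h₂ => .inl ?_, fun w ξ₁ I₁ u₁ ξ₂ I₂ u₂ h => ?_⟩
    · have h₁ := h₁.subset (by simp : κ₁ ∈ w ++ [κ₁])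
      have h₂ := h₂.subset (by simp : κ₂ ∈ w ++ [κ₂])
      simp only [List.mem_singleton] at h₁ h₂
      rw [h₁, h₂]
    · have : Action.proper .minus ξ₁ I₁ ∈ [Action.daimon] := by rw [h]; simp
      simp at this
  · rintro c rfl d hd hne
    rcases List.prefix_concat_iff (l₂ := []).1 hd with h | h
    · exact h
    · exact absurd (List.prefix_nil.1 h) hne
  · rintro c rfl - κ hκ
    simp only [List.getLast?_singleton, Option.mem_def, Option.some.injEq] at hκ
    rw [← hκ]
    rfl

/-- The negative design that answers a daimon to every initial action. -/
def negativeDaimon (β : Base) : Set (List Action) :=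
  {c | ∃ I, c = [.proper .minus β.addr I] ∨ c = [.proper .minus β.addr I, .daimon]}

theorem isDesign_negativeDaimon {β : Base} (hβ : β.polarity = .minus) :
    IsDesign β (negativeDaimon β) := by
  have hi : ∀ I, Initial β (.proper .minus β.addr I) := fun I => ⟨rfl, hβ.symm⟩
  have hplay : ∀ I, Play β [.proper .minus β.addr I] := fun I => by
    exact (play_nil β).append_singleton (by simp) (by simp) (by simp) (.inl (hi I))
  have hc₂ : ∀ I, IsChronicle β [.proper .minus β.addr I, .daimon] := fun I => by
    have hpath := (hplay I).isPath_close
    rw [close_of_plus rfl] at hpath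
    refine ⟨hpath, by simp, fun w κ h hκ hn => ?_⟩
    have := h.subset (by simp : κ ∈ w ++ [κ])
    simp only [List.mem_cons, List.not_mem_nil, or_false] at this
    rcases this with rfl | rfl
    · exact absurd (hi I) hn
    · simp at hκ
  have hc₁ : ∀ I, IsChronicle β [.proper .minus β.addr I] := fun I => by
    refine ⟨⟨by simp, ?_, ?_, by simp [focuses, Action.focus], by simp, by simp, ?_⟩, by simp, ?_⟩
    · intro w κ h hκ
      exact (hc₂ I).isPath.justification w κ (h.trans ⟨[.daimon], rfl⟩) hκ
    · intro κ hκ κ' hκ' hp hj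
      simp only [List.mem_singleton] at hκ
      rw [hκ] at hp
      cases hp
    · intro h
      rw [hβ] at h
      cases h
    · intro w κ h hκ hn
      exact (hc₂ I).negative_justified w κ (h.trans ⟨[.daimon], rfl⟩) hκ hn
  refine ⟨?_, ?_, ?_, ?_, fun h => ?_⟩
  · rintro c ⟨I, rfl | rfl⟩
    exacts [hc₁ I, hc₂ I]
  · intro c hc d hd
    have shape : ∀ c ∈ negativeDaimon β, ∀ w κ, w ++ [κ] <+: c →
        w = [] ∧ κ.polarity = .minus ∨ w ≠ [] ∧ κ = .daimon := by
      rintro c ⟨I, hc⟩ w κ h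
      have h : w ++ [κ] <+: [.proper .minus β.addr I, .daimon] := by
        rcases hc with rfl | rfl
        exacts [h.trans ⟨[.daimon], rfl⟩, h]
      cases w with
      | nil =>
        simp only [List.nil_append, List.cons_prefix_cons] at h
        exact .inl ⟨rfl, by rw [h.1]; rfl⟩
      | cons a w =>
        right
        refine ⟨by simp, ?_⟩
        rw [List.cons_append, List.cons_prefix_cons] at h
        have := h.2.subset (by simp : κ ∈ w ++ [κ])
        simpa using this
    refine ⟨fun w κ₁ κ₂ h₁ h₂ => ?_, fun w ξ₁ I₁ u₁ ξ₂ I₂ u₂ h₁ h₂ hne => ?_⟩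
    · rcases shape c hc w κ₁ h₁ with ⟨e, h₁⟩ | ⟨e, h₁⟩
      · rcases shape d hd w κ₂ h₂ with ⟨-, h₂⟩ | ⟨e', -⟩
        exacts [.inr ⟨h₁, h₂⟩, absurd e e']
      · rcases shape d hd w κ₂ h₂ with ⟨e', -⟩ | ⟨-, h₂⟩
        exacts [absurd e' e, .inl (h₁.trans h₂.symm)]
    · have s₁ := shape c hc w _ ⟨u₁, by simpa using h₁.symm⟩
      simp only [reduceCtorEq, and_false, or_false] at s₁
      obtain ⟨rfl, -⟩ := s₁
      have addr : ∀ c ∈ negativeDaimon β, ∀ ξ I u, c = .proper .minus ξ I :: u → ξ = β.addr := by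
        rintro c ⟨J, rfl | rfl⟩ ξ I u e
        all_goals
          simp only [List.cons.injEq, Action.proper.injEq, true_and] at e
          exact e.1.1.symm
      exact absurd ((addr c hc _ _ _ h₁).trans (addr d hd _ _ _ h₂).symm) hne
  · rintro c ⟨I, hc⟩ d hd hne
    have hd : d <+: [.proper .minus β.addr I, .daimon] := by
      rcases hc with rfl | rfl
      exacts [hd.trans ⟨[.daimon], rfl⟩, hd]
    rcases List.prefix_concat_iff (l₂ := [_]).1 hd with h | h
    · exact ⟨I, .inr h⟩
    · rcases List.prefix_concat_iff (l₂ := []).1 h with h | h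
      · exact ⟨I, .inl h⟩
      · exact absurd (List.prefix_nil.1 h) hne
  · rintro c ⟨I, rfl | rfl⟩ hmax
    · have := hmax _ ⟨I, .inr rfl⟩ ⟨[.daimon], rfl⟩
      simp at this
    · intro κ hκ
      simp only [List.getLast?_cons_cons, List.getLast?_singleton, Option.mem_def,
        Option.some.injEq] at hκ
      rw [← hκ]
      rfl
  · rw [hβ] at h
    cases h

theorem IsDesign.exists_singleton {β : Base} {D : Set (List Action)} (hD : IsDesign β D)
    (hβ : β.polarity = .plus) : [Action.daimon] ∈ D ∨ ∃ I, [Action.proper .plus β.addr I] ∈ D := by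
  obtain ⟨c, hc⟩ := hD.nonempty hβ
  obtain ⟨κ, hκ, h⟩ := (hD.chronicle c hc).isPath.totality hβ
  have hm : [κ] ∈ D := by
    refine hD.prefix_closed c hc _ ?_ (by simp)
    cases c with
    | nil => simp at hκ
    | cons a c =>
      simp only [List.head?_cons, Option.some.injEq] at hκ
      subst hκ
      exact ⟨c, rfl⟩
  rcases h with rfl | ⟨hf, hp⟩
  · exact .inl hm
  · right
    cases κ with
    | daimon => simp at hf
    | proper ε ξ I =>
      simp only [Action.focus, Option.some.injEq] at hf
      have hε : ε = .plus := hp.trans hβ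
      rw [hε, hf] at hm
      exact ⟨I, hm⟩

/-- The sequences visited in `A` by the interactions with `B`. -/
def Visited (A B : Set (Set (List Action))) (p : List Action) : Prop :=
  ∃ D ∈ A, ∃ E ∈ B, Interact D E p

theorem Visited.symm {A B : Set (Set (List Action))} {p : List Action} (h : Visited A B p) :
    Visited B A (dual p) := by
  obtain ⟨D, hD, E, hE, h⟩ := h
  exact ⟨E, hE, D, hD, h.symm⟩

namespace DualPair

variable {β : Base} {A B : Set (Set (List Action))}

theorem daimon_mem (h : DualPair β A B) (hβ : β.polarity = .plus) : {[Action.daimon]} ∈ A :=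
  (h.mem_left _).2 ⟨isDesign_daimon hβ, fun _ _ => ⟨_, .daimon_left rfl⟩⟩

theorem negativeDaimon_mem (h : DualPair β A B) (hβ : β.polarity = .minus) :
    negativeDaimon β ∈ A := by
  refine (h.mem_left _).2 ⟨isDesign_negativeDaimon hβ, fun E hE => ?_⟩
  rcases (h.isDesign_right hE).exists_singleton (by simpa using hβ) with hd | ⟨I, hI⟩
  · exact ⟨_, .daimon_right hd⟩
  · refine ⟨_, .right (σ := β.addr) (I := I) ⟨I, .inl rfl⟩ hI (.daimon_left ?_)⟩
    exact .inl ⟨by simp, I, .inr rfl⟩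

theorem nonempty_left (h : DualPair β A B) : A.Nonempty := by
  by_cases hβ : β.polarity = .plus
  · exact ⟨_, h.daimon_mem hβ⟩
  · exact ⟨_, h.negativeDaimon_mem (by simpa using hβ)⟩

theorem nonempty_right (h : DualPair β A B) : B.Nonempty := h.symm.nonempty_left

theorem visited_close_nil (h : DualPair β A B) : Visited A B (close β []) := by
  by_cases hβ : β.polarity = .plus
  · obtain ⟨E, hE⟩ := h.nonempty_right
    rw [close_of_plus (by simpa using hβ)]
    exact ⟨_, h.daimon_mem hβ, E, hE, .daimon_left rfl⟩
  · have hβ : β.polarity = .minus := by simpa using hβ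
    obtain ⟨D, hD⟩ := h.nonempty_left
    rw [close_of_minus (by simpa using hβ)]
    exact ⟨D, hD, _, h.symm.daimon_mem (by simpa using hβ), .daimon_right rfl⟩

/-- The sequences of justifiers of a visited sequence are trivial chronicles. -/
theorem exists_trivialChronicle (h : DualPair β A B) {p : List Action} (hp : Visited A B p)
    {l r : List Action} {κ : Action} (e : core p = l ++ κ :: r) :
    ∃ t, IsJustifierSequence β (l ++ [κ]) κ t ∧ IsTrivialChronicle β A t := by
  obtain ⟨D, hD, E, hE, hp⟩ := hp
  obtain ⟨s, es⟩ := (h.visitedPath hD hE hp).eq_append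
  obtain ⟨u, hu, huκ⟩ := h.travels_visitedPart hD hE hp l κ (r ++ s) (by rw [es, e]; simp)
  have hmat := h.material_visitedPart h.nonempty_right hD
  have hκ : κ ≠ .daimon := (mem_core.1 (by rw [e]; simp : κ ∈ core p)).2
  have hj := ((h.isDesign_left hmat.1).chronicle _ huκ).isPath.justified
  obtain ⟨t, ht⟩ := hj.exists_isJustifierSequence hκ
  exact ⟨t, ht.mono (hu.append (List.Sublist.refl _)), _, hmat, _, huκ, κ, by simp, hκ, ht⟩

end DualPair

/-! ### Regular behaviours are shuffle-regular -/

theorem regularPath_of_core {β : Base} {A : Set (Set (List Action))} {p : List Action}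
    (hp : Reversible β p) (h : ∀ κ ∈ core p, ∃ t, IsJustifierSequence β (core p) κ t ∧
      IsTrivialChronicle β A t) : RegularPath β A p := by
  refine ⟨hp, fun κ hκ hne => ?_⟩
  obtain ⟨t, ht, ht'⟩ := h κ (mem_core.2 ⟨hκ, hne⟩)
  exact ⟨t, isJustifierSequence_core.1 ht, ht'⟩

theorem SegmentShuffle.spec {a b t : List Action} (h : SegmentShuffle a b t) :
    a <+ t ∧ b <+ t ∧ ∀ κ ∈ t, κ ∈ a ∨ κ ∈ b := by
  obtain ⟨-, -, -, -, L, -, rfl, rfl, rfl, -⟩ := h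
  induction L with
  | nil => simp
  | cons x L ih =>
    obtain ⟨h₁, h₂, h₃⟩ := ih
    simp only [List.map_cons, List.flatten_cons]
    refine ⟨(List.sublist_append_left _ _).append h₁, (List.sublist_append_right _ _).append h₂,
      fun κ hκ => ?_⟩
    simp only [List.mem_append] at hκ ⊢
    rcases hκ with (hκ | hκ) | hκ
    · exact .inl (.inl hκ)
    · exact .inr (.inl hκ)
    · rcases h₃ κ hκ with h | h
      exacts [.inl (.inr h), .inr (.inr h)]

/-- Prefixes appear because, when both segments end with a daimon, one of them is truncated before
shuffling. -/
theorem Shuffle.spec {p q r : List Action} (h : Shuffle p q r) :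
    ∃ p' q', p' <+: p ∧ q' <+: q ∧ p' <+ r ∧ q' <+ r ∧ ∀ κ ∈ r, κ ∈ p' ∨ κ ∈ q' := by
  obtain ⟨s, a, b, t, -, rfl, rfl, rfl, h⟩ := h
  have key : ∀ a' b', a' <+: a → b' <+: b → SegmentShuffle a' b' t →
      ∃ p' q', p' <+: s ++ a ∧ q' <+: s ++ b ∧ p' <+ s ++ t ∧ q' <+ s ++ t ∧
        ∀ κ ∈ s ++ t, κ ∈ p' ∨ κ ∈ q' := by
    intro a' b' ha hb h
    obtain ⟨h₁, h₂, h₃⟩ := h.spec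
    refine ⟨s ++ a', s ++ b', (List.prefix_append_right_inj s).2 ha,
      (List.prefix_append_right_inj s).2 hb, (List.Sublist.refl s).append h₁,
      (List.Sublist.refl s).append h₂, fun κ hκ => ?_⟩
    simp only [List.mem_append] at hκ ⊢
    rcases hκ with hκ | hκ
    · exact .inl (.inl hκ)
    · rcases h₃ κ hκ with h | h
      exacts [.inl (.inr h), .inr (.inr h)]
  rcases h with h | ⟨a', κ₁, b', κ₂, rfl, rfl, h | h⟩
  · exact key a b (List.prefix_refl _) (List.prefix_refl _) h
  · exact key _ b' (List.prefix_refl _) (List.prefix_append _ _) h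
  · exact key a' _ (List.prefix_append _ _) (List.prefix_refl _) h

theorem Shuffle.exists_core_append {p q r : List Action} (h : Shuffle p q r) {κ : Action}
    (hκ : κ ∈ core r) : ∃ p₀, (p₀ = p ∨ p₀ = q) ∧ ∃ l s, core p₀ = l ++ κ :: s ∧
      l ++ [κ] <+ core r := by
  obtain ⟨p', q', hp, hq, hp', hq', h⟩ := h.spec
  obtain ⟨hκ, hne⟩ := mem_core.1 hκ
  have key : ∀ {p' p : List Action}, p' <+: p → p' <+ r → κ ∈ p' →
      ∃ l s, core p = l ++ κ :: s ∧ l ++ [κ] <+ core r := by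
    intro p' p hp hp' hm
    obtain ⟨l, s, e⟩ := List.mem_iff_append.1 (mem_core.2 ⟨hm, hne⟩)
    obtain ⟨s', e'⟩ := core_prefix_core hp
    refine ⟨l, s ++ s', by rw [← e', e]; simp, List.Sublist.trans ?_ (core_sublist_core hp')⟩
    rw [e]
    exact (List.Sublist.refl l).append (by simp)
  rcases h κ hκ with h | h
  exacts [⟨p, .inl rfl, key hp hp' h⟩, ⟨q, .inr rfl, key hq hq' h⟩]

namespace DualPair

variable {β : Base} {A B : Set (Set (List Action))}

theorem visited_chronicle (h : DualPair β A B) (hreg : ∀ p, RegularPath β A p → Visited A B p)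
    {D : Set (List Action)} (hD : Material A D) {c : List Action} (hc : c ∈ D)
    (hp : PositiveEnded c) : Visited A B c := by
  have hch := (h.isDesign_left hD.1).chronicle c hc
  refine hreg c ⟨hch.reversible hp, fun κ hκ hne => ?_⟩
  obtain ⟨l, r, e⟩ := List.mem_iff_append.1 hκ
  have e' : c = (l ++ [κ]) ++ r := by simpa using e
  obtain ⟨t, ht⟩ := (Justified.of_append (e' ▸ hch.isPath.justified)).exists_isJustifierSequence hne
  have ht := ht.mono (e' ▸ List.sublist_append_left (l ++ [κ]) r : l ++ [κ] <+ c)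
  exact ⟨t, ht, D, hD, c, hc, κ, hκ, hne, ht⟩

/-- Regularity concerns `A` alone, so `c` is dualized. Since `c` is extracted from a path visited in
`E`, the dual of that path is visited in `A` and its justifier sequences are trivial chronicles; by
uniqueness they are the ones computed in the dual of `c`. -/
theorem visited_chronicle_right (h : DualPair β A B)
    (hreg : ∀ p, RegularPath β A p → Visited A B p) {E : Set (List Action)} (hE : Material B E)
    {c : List Action} (hc : c ∈ E) (hp : PositiveEnded c) : Visited B A c := by
  have hch := (h.isDesign_right hE.1).chronicle c hc
  have hrev := hch.reversible hp
  rw [← hrev.dual_dual]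
  refine (hreg _ (regularPath_of_core (by simpa using hrev.dual) fun κ hκ => ?_)).symm
  rw [core_dual] at hκ ⊢
  obtain ⟨κ, hκ', rfl⟩ := List.mem_map.1 hκ
  have hne := (mem_core.1 hκ').2
  obtain ⟨l₀, r₀, e⟩ := List.mem_iff_append.1 hκ'
  have hj := hch.play_core.justified
  have e' : core c = (l₀ ++ [κ]) ++ r₀ := by simpa using e
  rw [e'] at hj
  obtain ⟨t, ht⟩ := hj.of_append.exists_isJustifierSequence hne
  have ht := (ht.mono (e' ▸ List.sublist_append_left (l₀ ++ [κ]) r₀ : l₀ ++ [κ] <+ core c)).map_bar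
  rw [Base.dual_dual] at ht
  refine ⟨_, ht, ?_⟩
  obtain ⟨-, D, hD, l, x, r, u, hint, hu, rfl⟩ := h.symm.visitedPart_eq h.nonempty_left hE hc
  have hvis := hint.symm.visitedPath (h.isDesign_left hD) (h.isDesign_right hE.1)
  have hsub : core (u ++ [x]) <+ core (l ++ x :: r) :=
    core_sublist_core (hu.append (by simp))
  have hmem : κ.bar ∈ core (dual (l ++ x :: r)) := by
    rw [core_dual]
    exact List.mem_map_of_mem (hsub.subset hκ')
  obtain ⟨l₁, r₁, e₁⟩ := List.mem_iff_append.1 hmem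
  obtain ⟨t', ht', htriv⟩ := h.exists_trivialChronicle ⟨D, hD, E, hE.1, hint.symm⟩ e₁
  have h₁ : IsJustifierSequence β (core (dual (l ++ x :: r))) κ.bar t' := by
    refine ht'.mono ?_
    rw [e₁]
    exact (List.Sublist.refl l₁).append (by simp)
  have h₂ : IsJustifierSequence β (core (dual (l ++ x :: r))) κ.bar (t.map Action.bar) := by
    refine ht.mono ?_
    rw [core_dual]
    exact hsub.map _
  rwa [h₂.unique (hvis.linear.sublist (core_sublist _)) h₁]

theorem visited_shuffle (h : DualPair β A B) (hreg : ∀ p, RegularPath β A p → Visited A B p)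
    {p q r : List Action} (hp : Visited A B p) (hq : Visited A B q) (hs : Shuffle p q r)
    (hr : Reversible β r) : Visited A B r := by
  refine hreg r (regularPath_of_core hr fun κ hκ => ?_)
  obtain ⟨p₀, hp₀, l, s, e, hl⟩ := hs.exists_core_append hκ
  have hv : Visited A B p₀ := by rcases hp₀ with rfl | rfl <;> assumption
  obtain ⟨t, ht, ht'⟩ := h.exists_trivialChronicle hv e
  exact ⟨t, ht.mono hl, ht'⟩

theorem visited_shuffle_right (h : DualPair β A B)
    (hreg : ∀ p, RegularPath β A p → Visited A B p) {p q r : List Action} (hp : Visited B A p)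
    (hq : Visited B A q) (hs : Shuffle p q r) (hr : Reversible β.dual r) : Visited B A r := by
  rw [← hr.dual_dual]
  refine (hreg _ (regularPath_of_core (by simpa using hr.dual) fun κ hκ => ?_)).symm
  rw [core_dual] at hκ ⊢
  obtain ⟨κ, hκ', rfl⟩ := List.mem_map.1 hκ
  obtain ⟨p₀, hp₀, l, s, e, hl⟩ := hs.exists_core_append hκ'
  have hv : Visited B A p₀ := by rcases hp₀ with rfl | rfl <;> assumption
  obtain ⟨t, ht, ht'⟩ := h.exists_trivialChronicle hv.symm
    (l := l.map Action.bar) (κ := κ.bar) (r := s.map Action.bar) (by rw [core_dual, e]; simp)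
  exact ⟨t, ht.mono (by simpa using hl.map Action.bar), ht'⟩

end DualPair

/-! ### Decomposition of a play as a shuffle -/

/-- Every negative action that is not the first is justified by the action before it. -/
def Direct (w : List Action) : Prop :=
  ∀ l κ r, w = l ++ κ :: r → κ.polarity = .minus →
    l = [] ∨ ∃ l' x, l = l' ++ [x] ∧ Justifies x κ

/-- Choosing the last offending action makes every later negative action directly justified, as
`Play.remove` requires. -/
theorem exists_last_of_not_direct {w : List Action} (h : ¬ Direct w) :
    ∃ l κ r, w = l ++ κ :: r ∧ κ.polarity = .minus ∧ l ≠ [] ∧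
      (¬ ∃ l' x, l = l' ++ [x] ∧ Justifies x κ) ∧
      ∀ r₁ a r₂, r = r₁ ++ a :: r₂ → a.polarity = .minus →
        ∃ l' x, l ++ κ :: r₁ = l' ++ [x] ∧ Justifies x a := by
  simp only [Direct, not_forall, not_or] at h
  obtain ⟨l, κ, r, e, hp, hl, hj⟩ := h
  induction hn : r.length using Nat.strong_induction_on generalizing l κ r with
  | _ n ih =>
    by_cases hr : ∀ r₁ a r₂, r = r₁ ++ a :: r₂ → a.polarity = .minus →
        ∃ l' x, l ++ κ :: r₁ = l' ++ [x] ∧ Justifies x a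
    · exact ⟨l, κ, r, e, hp, hl, hj, hr⟩
    · push Not at hr
      obtain ⟨r₁, a, r₂, rfl, ha, hne⟩ := hr
      exact ih r₂.length (by rw [← hn]; simp; omega) (l ++ κ :: r₁) a r₂ (by simp [e]) ha (by simp)
        (by rintro ⟨l', x, h₁, h₂⟩; exact hne l' x h₁ h₂) rfl

/-- A jump starting in `r` never lands in `q`: it stays in `κ :: r` as long as the negative actions
met lie in `r`, and on reaching `κ` it passes to `γ` in `s`, after which it remains in `s`. -/
theorem NegJump.of_remove {β : Base} {s q r : List Action} {γ κ : Action}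
    (h : Play β (s ++ q ++ κ :: r)) (hγ : γ ∈ s) (hj : Justifies γ κ)
    (hκ : κ.polarity = .minus)
    (hd : ∀ r₁ a r₂, r = r₁ ++ a :: r₂ → a.polarity = .minus →
      ∃ x ∈ κ :: r₁, Justifies x a) {y z : Action} (hz : z ∈ r) (hp : z.polarity = .plus)
    (hjump : NegJump (s ++ q ++ κ :: r) y z) : NegJump (s ++ κ :: r) y z := by
  have hsuf : κ :: r <:+: s ++ κ :: r := (List.suffix_append _ _).isInfix
  induction hjump with
  | direct hi => exact .direct ((infix_of_mem_right h.linear.nodup hz hi).trans hsuf)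
  | @step z α δ hi hδ hδα hj' ih =>
    have hi' := infix_of_mem_right h.linear.nodup hz hi
    have hα : α.polarity = .minus := by
      have := h.alternation.infix hi
      rw [List.isChain_cons_cons, hp] at this
      simpa using this.1
    have hunique : ∀ x, x ∈ s ++ q ++ κ :: r → Justifies x α → x = δ := fun x hx hxα =>
      h.linear.eq_of_focus_eq hx hδ (hxα.focus_eq hδα rfl)
    rcases List.mem_cons.1 (hi'.subset (by simp : α ∈ [α, z])) with rfl | hαr
    · have e := hunique γ (by simp [hγ]) hj
      subst e
      have h₁ : NegJump (s ++ (q ++ α :: r)) y γ := by simpa using hj'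
      have h₂ := NegJump.of_mem_left (β := β) (by simpa using h.linear)
        (by simpa using h.justified) hγ h₁
      exact .step (hi'.trans hsuf) (by simp [hγ]) hj
        (h₂.mono (List.prefix_append _ _).isInfix)
    · obtain ⟨r₁, r₂, e⟩ := List.mem_iff_append.1 hαr
      obtain ⟨x, hx, hxα⟩ := hd r₁ α r₂ e hα
      have hxr : x ∈ κ :: r := by
        rw [e]
        rcases List.mem_cons.1 hx with rfl | hx <;> simp [*]
      have e' := hunique x (by simp only [List.mem_append]; exact .inr hxr) hxα
      subst e'
      have hxp : x.polarity = .plus := by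
        have := hxα.polarity
        rw [hα] at this
        simpa using this.symm
      have hxr' : x ∈ r := by
        rcases List.mem_cons.1 hxr with rfl | hxr
        · rw [hκ] at hxp
          cases hxp
        · exact hxr
      exact .step (hi'.trans hsuf) (by simp [hxr']) hxα (ih hxr' hxp)

theorem Play.remove {β : Base} {s q r : List Action} {γ κ : Action}
    (h : Play β (s ++ [γ] ++ q ++ κ :: r)) (hj : Justifies γ κ) (hκ : κ.polarity = .minus)
    (hd : ∀ r₁ a r₂, r = r₁ ++ a :: r₂ → a.polarity = .minus →
      ∃ l' x, κ :: r₁ = l' ++ [x] ∧ Justifies x a) : Play β (s ++ [γ] ++ κ :: r) := by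
  induction r using List.reverseRecOn with
  | nil =>
    have hs : Play β (s ++ [γ]) := Play.of_append (r := q ++ [κ]) (by simpa using h)
    have hl : Linear (s ++ [γ] ++ [κ]) := h.linear.sublist
      ((List.sublist_append_left _ _).append (List.Sublist.refl _))
    refine hs.append_singleton hj.ne_daimon_right ?_ (linear_append_singleton.1 hl).2
      (.inr ⟨γ, by simp, hj, .direct ⟨s, [], by simp⟩⟩)
    intro κ' hκ'
    simp only [List.getLast?_append, List.getLast?_singleton, Option.some_or, Option.mem_def,
      Option.some.injEq] at hκ'
    rw [← hκ', Polarity.ne_iff]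
    exact hj.polarity
  | append_singleton r x ih =>
    have e₀ : s ++ [γ] ++ q ++ κ :: (r ++ [x]) = (s ++ [γ] ++ q ++ κ :: r) ++ [x] := by simp
    have e₁ : s ++ [γ] ++ κ :: (r ++ [x]) = (s ++ [γ] ++ κ :: r) ++ [x] := by simp
    have ih := ih (Play.of_append (e₀ ▸ h)) fun r₁ a r₂ e => hd r₁ a (r₂ ++ [x]) (by simp [e])
    have hl : Linear (s ++ [γ] ++ κ :: r ++ [x]) := h.linear.sublist (by
      rw [e₀]
      exact ((List.sublist_append_left _ _).append (List.Sublist.refl _)).append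
        (List.Sublist.refl _))
    have hx : x ≠ .daimon := fun e => h.proper (by simp [e])
    rw [e₁]
    obtain ⟨m, y, ey⟩ : ∃ m y, κ :: r = m ++ [y] :=
      (eq_nil_or_append_singleton (κ :: r)).resolve_left (by simp)
    refine ih.append_singleton hx ?_ (linear_append_singleton.1 hl).2 ?_
    · intro κ' hκ'
      have ha := h.alternation
      rw [e₀, ey, List.isChain_append] at ha
      rw [ey] at hκ'
      rw [← List.append_assoc, List.getLast?_concat] at hκ'
      exact ha.2.2 κ' (by rw [← List.append_assoc, List.getLast?_concat]; exact hκ') x (by simp)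
    · by_cases hp : x.polarity = .plus
      · have hju := h.justified
        rw [e₀] at hju
        rcases hju _ x [] rfl hx with hi | ⟨y, hy, hyx⟩
        · exact .inl hi
        · right
          have hjump := NegJump.of_remove h (by simp) hj hκ
            (fun r₁ a r₂ e ha => by
              obtain ⟨l', z, h₁, h₂⟩ := hd r₁ a r₂ e ha
              exact ⟨z, by rw [h₁]; simp, h₂⟩)
            (by simp) hp (h.jump x (by simp) y (by rw [e₀]; exact List.mem_append_left _ hy) hyx)
          rw [e₁] at hjump
          -- The surviving jump also shows that the justifier `y` was not deleted along with `q`.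
          refine ⟨y, ?_, hyx, hjump⟩
          rcases List.mem_append.1 hjump.mem_left with hm | hm
          · exact hm
          · rw [List.mem_singleton] at hm
            subst hm
            have := hyx.polarity
            rw [hp] at this
            cases this
      · obtain ⟨l', z, h₁, h₂⟩ := hd r x [] rfl (by simpa using hp)
        refine .inr ⟨z, by rw [h₁]; simp, h₂, .direct ⟨s ++ [γ] ++ l', [], ?_⟩⟩
        rw [h₁]
        simp

theorem exists_close_eq_append (β : Base) (κ : Action) (r : List Action) :
    ∃ t, ∀ l, close β (l ++ κ :: r) = l ++ κ :: (r ++ t) := by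
  have ht : ∀ l, turn β (l ++ κ :: r) = turn β (κ :: r) := fun l => by
    simp [turn, List.getLast?_append, List.getLast?_cons]
  rcases turn_cases β (κ :: r) with h | h
  · exact ⟨[.daimon], fun l => by rw [close_of_plus ((ht l).trans h)]; simp⟩
  · exact ⟨[], fun l => by rw [close_of_minus ((ht l).trans h)]; simp⟩

/-- Split at the last offending `κ`: after the common past `s γ`, the segments `q` and `κ r` both
start with a negative action. As `κ` does not directly follow `γ`, `q` is non-empty and both plays
are shorter. -/
theorem Play.exists_shuffle {β : Base} {w : List Action} (h : Play β w) (hw : ¬ Direct w) :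
    ∃ w₁ w₂, Play β w₁ ∧ Play β w₂ ∧ w₁ <+ w ∧ w₂ <+ w ∧ w₁.length < w.length ∧
      w₂.length < w.length ∧ Shuffle (close β w₁) (close β w₂) (close β w) := by
  obtain ⟨l, κ, r, rfl, hκ, hne, hbad, hgood⟩ := exists_last_of_not_direct hw
  have hl : Action.daimon ∉ l := fun hm => h.proper (by simp [hm])
  have hi : ¬ Initial β κ := fun hi =>
    hne (h.justified.eq_nil_of_initial h.linear hl hi)
  obtain ⟨γ, hγ, hj⟩ := (h.justified l κ r rfl (Action.ne_daimon_of_minus hκ)).resolve_left hi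
  obtain ⟨s, q, e⟩ := List.mem_iff_append.1 hγ
  have e : l = s ++ [γ] ++ q := by simpa using e
  subst e
  have hq : q ≠ [] := by
    rintro rfl
    exact hbad ⟨s, γ, by simp, hj⟩
  have h₂ : Play β (s ++ [γ] ++ κ :: r) := by
    refine h.remove hj hκ fun r₁ a r₂ e ha => ?_
    obtain ⟨l', x, e', hx⟩ := hgood r₁ a r₂ e ha
    obtain ⟨m, y, ey⟩ : ∃ m y, κ :: r₁ = m ++ [y] :=
      (eq_nil_or_append_singleton (κ :: r₁)).resolve_left (by simp)
    rw [ey, ← List.append_assoc] at e'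
    obtain ⟨-, e''⟩ := List.append_inj' e' rfl
    simp only [List.cons.injEq, and_true] at e''
    exact ⟨m, y, ey, e'' ▸ hx⟩
  have hγp : γ.polarity = .plus := by
    have := hj.polarity
    rw [hκ] at this
    simpa using this.symm
  have ha := h.alternation
  rw [List.isChain_append] at ha
  have hlast : PositiveEnded q := by
    intro x hx
    have := ha.2.2 x (by
      rw [List.getLast?_append]
      rw [Option.mem_def] at hx ⊢
      rw [hx]
      rfl) κ (by simp)
    rw [hκ] at this
    simpa using this
  have hhead : ∀ x ∈ q.head?, x.polarity = .minus := by
    intro x hx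
    have := (List.isChain_append.1 ha.1).2.2 γ (by simp) x hx
    rw [hγp, Polarity.ne_iff] at this
    exact this
  have hturn : turn β (s ++ [γ] ++ q) = .minus := by
    obtain ⟨q', x, rfl⟩ := (eq_nil_or_append_singleton q).resolve_left hq
    rw [← List.append_assoc, turn_append_singleton, hlast x (by simp)]
    rfl
  refine ⟨s ++ [γ] ++ q, s ++ [γ] ++ κ :: r, h.of_append, h₂, List.sublist_append_left _ _,
    (List.sublist_append_left _ _).append (List.Sublist.refl _), by simp, ?_, ?_⟩
  · have := List.length_pos_iff.2 hq
    simp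
    omega
  · obtain ⟨t, ht⟩ := exists_close_eq_append β κ r
    have hpath := h.isPath_close
    have hpos := positiveEnded_close β (s ++ [γ] ++ κ :: r)
    rw [close_of_minus hturn, ht, ht]
    rw [ht] at hpath hpos
    refine ⟨s ++ [γ], q, κ :: (r ++ t), q ++ κ :: (r ++ t), ?_, rfl, rfl, by simp, .inl ?_⟩
    · intro x hx
      simp only [List.getLast?_append, List.getLast?_singleton, Option.some_or, Option.mem_def,
        Option.some.injEq] at hx
      rw [← hx]
      exact hγp
    -- One block suffices, since the shuffle is a concatenation; `t` is the closing daimon or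
    -- nothing.
    refine ⟨⟨hhead, hlast⟩, ⟨?_, ?_⟩, ?_, ?_, [(q, κ :: (r ++ t))], ?_, by simp, by simp, by simp,
      ?_⟩
    · simpa using hκ
    · intro x hx
      refine hpos x ?_
      rw [List.getLast?_append]
      rw [Option.mem_def] at hx ⊢
      rw [hx]
      rfl
    · have hlin := hpath.linearity
      rw [focuses_append, focuses_append (s ++ [γ])] at hlin
      exact (List.disjoint_of_nodup_append (List.append_assoc _ _ _ ▸ hlin).of_append_right)
    · rintro ⟨h', -⟩
      exact hl (by simp [List.mem_of_getLast? h'])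
    · intro x hx
      rw [List.mem_singleton] at hx
      subst hx
      refine ⟨⟨hhead, hlast⟩, by simpa using hκ, ?_⟩
      intro x hx
      refine hpos x ?_
      rw [List.getLast?_append]
      rw [Option.mem_def] at hx ⊢
      rw [hx]
      rfl
    · have := hpath.daimon_last
      rw [List.append_assoc _ q, List.dropLast_append_of_ne_nil (by simp)] at this
      exact fun hm => this (List.mem_append_right _ hm)

/-! ### Trivial chronicles are visitable -/

/-- A chronicle extracted from a visited path whose positive actions are justified by the action
before them is a sequence of justifiers. -/
theorem VisitedPath.isJustifierSequence {β : Base} {E : Set (List Action)} (hE : IsDesign β E)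
    {m s u : List Action} {x : Action} (h : VisitedPath β E (m ++ x :: s)) (hx : x ≠ .daimon)
    (hd : ∀ l a r, m ++ [x] = l ++ a :: r → a.polarity = .plus →
      l = [] ∨ ∃ l' y, l = l' ++ [y] ∧ Justifies y a)
    (hu : u <+ m) (hux : u ++ [x] ∈ E) : IsJustifierSequence β (m ++ [x]) x (u ++ [x]) := by
  refine ⟨hu.append (List.Sublist.refl _), by simp, ?_, ?_⟩
  · rw [List.isChain_iff_forall_rel_of_append_cons_cons]
    intro a b l₁ l₂ e
    have e' : u ++ [x] = (l₁ ++ [a] ++ [b]) ++ l₂ := by simpa using e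
    have hab : l₁ ++ [a] ++ [b] ∈ E :=
      hE.prefix_closed _ hux _ (by rw [e']; exact List.prefix_append _ _) (by simp)
    by_cases hb : b.polarity = .plus
    · have hsub : l₁ ++ [a] ++ [b] <+ m ++ [x] :=
        (List.sublist_append_left _ l₂).trans (e' ▸ hu.append (List.Sublist.refl _))
      obtain ⟨L, R, eL, hL⟩ := exists_prefix_of_append_singleton_sublist hsub
      have hv : VisitedPath β E (L ++ b :: (R ++ s)) := by
        have : m ++ x :: s = L ++ b :: (R ++ s) := by
          rw [← List.singleton_append, ← List.append_assoc, eL]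
          simp
        rwa [← this]
      rcases hv.last_of_plus hE hL hab hb with ⟨h₀, -⟩ | ⟨u', L', a', e₁, rfl, -⟩
      · simp at h₀
      · obtain ⟨-, e₂⟩ := List.append_inj' e₁ rfl
        simp only [List.cons.injEq, and_true] at e₂
        subst e₂
        rcases hd _ b R eL hb with h₀ | ⟨l', y, e₃, hy⟩
        · simp at h₀
        · obtain ⟨-, e₄⟩ := List.append_inj' e₃ rfl
          simp only [List.cons.injEq, and_true] at e₄
          rwa [e₄]
    · exact hE.justifies_of_minus hab (by simpa using hb)
  · obtain ⟨a, v, e⟩ := List.exists_cons_of_ne_nil (by simp : u ++ [x] ≠ [])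
    refine ⟨a, by rw [e]; rfl, ?_⟩
    have ha : a ≠ .daimon := by
      rintro rfl
      have hm : Action.daimon ∈ u ++ [x] := by rw [e]; simp
      rcases List.mem_append.1 hm with hm | hm
      · exact hE.ne_daimon_of_append_cons hux hm
      · exact hx (List.mem_singleton.1 hm).symm
    have := (hE.chronicle _ hux).isPath.justified [] a v e ha
    simpa using this

namespace DualPair

variable {β : Base} {A B : Set (Set (List Action))}

/-- Seen from `E`, the positive actions are the negative ones of the chronicle, hence each
non-initial one directly follows its justifier. Negative actions follow their justifiers in any
chronicle of `E`, so the chronicle that `E` extracts is a justifier sequence. -/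
theorem mem_material_of_visited (h : DualPair β A B) {l z v : List Action} {κ : Action}
    (hc : IsChronicle β (l ++ κ :: z)) (hκ : κ ≠ .daimon)
    (hw : IsJustifierSequence β (l ++ [κ]) κ v) (hv : Visited A B (l ++ κ :: z)) :
    ∃ E, Material B E ∧ ∃ s, dual (l ++ κ :: z) = l.map Action.bar ++ κ.bar :: s ∧
      VisitedPath β.dual E (l.map Action.bar ++ κ.bar :: s) ∧ v.map Action.bar ∈ E := by
  obtain ⟨D, hD, E₀, hE₀, hint⟩ := hv
  have hmat := h.symm.material_visitedPart h.symm.nonempty_right hE₀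
  have hint' := h.symm.interact_visitedPart hE₀ hD hint.symm
  have hvis := h.symm.visitedPath hmat.1 hD hint'
  obtain ⟨s, es⟩ := hvis.eq_append
  have hl : Action.daimon ∉ l := by
    have := hc.isPath.daimon_last
    rw [List.dropLast_append_of_ne_nil (by simp)] at this
    exact fun hm => this (List.mem_append_left _ hm)
  have ecore : core (l ++ κ :: z) = l ++ κ :: core z := by
    rw [core_append, core_eq_self hl]
    simp [core, hκ]
  rw [core_dual, ecore, List.map_append, List.map_cons, List.append_assoc, List.cons_append] at es
  rw [es] at hvis
  refine ⟨_, hmat, _, es, hvis, ?_⟩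
  have hE := h.isDesign_right hmat.1
  obtain ⟨u, hu, huκ⟩ := hvis.travels _ _ _ rfl
  have hlin := hc.isPath.linear
  have hjust := hc.isPath.justified
  have hd : ∀ l' a r, l.map Action.bar ++ [κ.bar] = l' ++ a :: r → a.polarity = .plus →
      l' = [] ∨ ∃ l'' y, l' = l'' ++ [y] ∧ Justifies y a := by
    intro l' a r e ha
    have e' : l ++ [κ] = l'.map Action.bar ++ a.bar :: r.map Action.bar := by
      have := congrArg (List.map Action.bar) e
      simpa using this
    have e'' : l ++ κ :: z = l'.map Action.bar ++ a.bar :: (r.map Action.bar ++ z) := by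
      rw [← List.singleton_append, ← List.append_assoc, e']
      simp
    have hlk : Action.daimon ∉ l ++ [κ] := by
      simp only [List.mem_append, List.mem_singleton, not_or]
      exact ⟨hl, hκ.symm⟩
    rw [e'] at hlk
    have had : a ≠ .daimon := by
      rintro rfl
      simp at hlk
    have hap : a.bar.polarity = .minus := by rw [Action.bar_polarity had, ha]; rfl
    rw [e''] at hc hlin hjust
    by_cases hi : Initial β a.bar
    · left
      have := hjust.eq_nil_of_initial hlin (fun hm => hlk (List.mem_append_left _ hm)) hi
      simpa using this
    · right
      obtain ⟨l₁, y, e₁, hy⟩ := hc.infix_of_minus hap hi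
      refine ⟨l₁.map Action.bar, y.bar, ?_, ?_⟩
      · have := congrArg (List.map Action.bar) e₁
        simpa using this
      · rw [← justifies_bar]
        simpa using hy
  have hjs := hvis.isJustifierSequence hE (by simpa using hκ) hd hu huκ
  have hlin' : Linear (l.map Action.bar ++ [κ.bar]) :=
    hvis.linear.sublist ((List.Sublist.refl _).append (by simp))
  have hw' := hw.map_bar
  rw [List.map_append, List.map_singleton] at hw'
  rwa [hw'.unique hlin' hjs]

theorem visited_trivialChronicle (h : DualPair β A B)
    (hA : ∀ D, Material A D → ∀ c ∈ D, PositiveEnded c → Visited A B c)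
    (hB : ∀ E, Material B E → ∀ c ∈ E, PositiveEnded c → Visited B A c)
    {w : List Action} (hw : IsTrivialChronicle β A w) : Visited A B (close β w) := by
  obtain ⟨D, hD, c, hc, κ, hκc, hκ, hjs⟩ := hw
  have hDd := h.isDesign_left hD.1
  obtain ⟨l, r, rfl⟩ := List.mem_iff_append.1 hκc
  have hwd := hjs.daimon_notMem
  obtain ⟨v, rfl⟩ := List.getLast?_eq_some_iff.1 hjs.2.1
  have hn : κ ∉ r := by
    have := (hDd.chronicle _ hc).isPath.linear.nodup
    rw [List.nodup_append, List.nodup_cons] at this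
    exact this.2.1.1
  have hv : v <+ l := sublist_of_append_singleton_sublist hn hjs.1
  have hjs' : IsJustifierSequence β (l ++ [κ]) κ (v ++ [κ]) :=
    ⟨hv.append (List.Sublist.refl _), hjs.2⟩
  have hlκ : l ++ [κ] ∈ D := hDd.prefix_closed _ hc _ ⟨r, by simp⟩ (by simp)
  suffices hs : Visited B A (close β.dual ((v ++ [κ]).map Action.bar)) by
    have := hs.symm
    rwa [dual_close (daimon_mem_map_bar.not.2 hwd), map_bar_map_bar, Base.dual_dual] at this
  -- For positive `κ` the reversed sequence ends negatively and `E` must continue it with a daimon: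
  -- this is the daimon of the dual of `l ++ [κ]`, whose chronicle extends that of `κ.bar`.
  by_cases hp : κ.polarity = .plus
  · have hvis := hA D hD _ hlκ (by simpa [PositiveEnded] using hp)
    obtain ⟨E, hE, s, es, hv', hm⟩ :=
      h.mem_material_of_visited (z := []) (hDd.chronicle _ hlκ) hκ hjs' hvis
    have hEd := h.isDesign_right hE.1
    have hld : Action.daimon ∉ l ++ [κ] := by
      simp only [List.mem_append, List.mem_singleton, not_or]
      exact ⟨hDd.ne_daimon_of_append_cons hlκ, hκ.symm⟩
    rw [dual_of_daimon_notMem hld] at es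
    rw [← es] at hv'
    have hminus : κ.bar.polarity = .minus := by rw [Action.bar_polarity hκ, hp]; rfl
    rw [close_of_plus (by
      rw [List.map_append, List.map_singleton, turn_append_singleton, hminus]; rfl)]
    refine hB E hE _ ?_ (by simp [PositiveEnded])
    obtain ⟨u, hu, hud⟩ := hv'.travels _ .daimon [] rfl
    rcases hv'.last_of_plus hEd hu hud rfl with ⟨-, h₀⟩ | ⟨u, l', x, rfl, e, -⟩
    · simp at h₀
    · rw [List.map_append, List.map_singleton] at e hu hv' hm ⊢
      obtain ⟨-, e₁⟩ := List.append_inj' e rfl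
      simp only [List.cons.injEq, and_true] at e₁
      subst e₁
      have hv'' : VisitedPath β.dual E (l.map Action.bar ++ κ.bar :: [.daimon]) := by
        simpa using hv'
      have : u = v.map Action.bar := hv''.view_unique hEd
        (sublist_of_append_singleton_sublist (r := []) (by simp) hu) (hv.map _)
        (hEd.prefix_closed _ hud _ (List.prefix_append _ _) (by simp)) hm
      rwa [← this]
  · have hp : κ.polarity = .minus := by simpa using hp
    -- Visitability is only known for positive-ended chronicles; one ending negatively is not
    -- maximal, so it can be extended by one action.
    have hext : ∃ x, l ++ κ :: [x] ∈ D := by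
      by_contra hno
      have hmax : ∀ d ∈ D, l ++ [κ] <+: d → d = l ++ [κ] := by
        rintro d hd ⟨t, rfl⟩
        cases t with
        | nil => simp
        | cons x t =>
          exact absurd ⟨x, hDd.prefix_closed _ hd _ ⟨t, by simp⟩ (by simp)⟩ hno
      have := hDd.maximal_positive _ hlκ hmax κ (by simp)
      rw [hp] at this
      cases this
    obtain ⟨x, hx⟩ := hext
    have hxp : x.polarity = .plus := by
      have := hDd.polarity_of_append_pair (u := l) (x := κ) (κ := x) (by simpa using hx)
      rw [hp, Polarity.ne_iff] at this
      exact this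
    have hvis := hA D hD _ hx (by simpa [PositiveEnded] using hxp)
    obtain ⟨E, hE, s, -, -, hm⟩ :=
      h.mem_material_of_visited (hDd.chronicle _ hx) hκ hjs' hvis
    have hplus : κ.bar.polarity = .plus := by rw [Action.bar_polarity hκ, hp]; rfl
    rw [close_of_minus (by
      rw [List.map_append, List.map_singleton, turn_append_singleton, hplus]; rfl)]
    exact hB E hE _ hm (by simpa [PositiveEnded] using hplus)

/-! ### Shuffle-regular behaviours are regular -/

theorem visited_of_play (h : DualPair β A B)
    (hA : ∀ D, Material A D → ∀ c ∈ D, PositiveEnded c → Visited A B c)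
    (hB : ∀ E, Material B E → ∀ c ∈ E, PositiveEnded c → Visited B A c)
    (hsA : ∀ p q r, Visited A B p → Visited A B q → Shuffle p q r → Reversible β r →
      Visited A B r)
    (hsB : ∀ p q r, Visited B A p → Visited B A q → Shuffle p q r → Reversible β.dual r →
      Visited B A r)
    {w : List Action} (hw : Play β w)
    (ht : ∀ κ ∈ w, ∃ t, IsJustifierSequence β w κ t ∧ IsTrivialChronicle β A t) :
    Visited A B (close β w) := by
  induction hn : w.length using Nat.strong_induction_on generalizing w with
  | _ n ih =>
    -- A play that is a subsequence of `w` has, by uniqueness, the same justifier sequences, so the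
    -- triviality hypothesis is inherited.
    have ih' : ∀ {w'}, Play β w' → w' <+ w → w'.length < w.length →
        Visited A B (close β w') := by
      intro w' hw' hsub hlen
      refine ih _ (hn ▸ hlen) hw' (fun κ hκ => ?_) rfl
      obtain ⟨l, r, rfl⟩ := List.mem_iff_append.1 hκ
      have hj : Justified β (l ++ [κ]) :=
        Justified.of_append (r := r) (by simpa using hw'.justified)
      obtain ⟨t, htj⟩ := hj.exists_isJustifierSequence (fun e => hw'.proper (e ▸ hκ))
      have htj := htj.mono ((List.Sublist.refl l).append (by simp) : l ++ [κ] <+ l ++ κ :: r)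
      obtain ⟨t', ht', htriv⟩ := ht κ (hsub.subset hκ)
      have e := (htj.mono hsub).unique hw.linear ht'
      exact ⟨t, htj, e ▸ htriv⟩
    by_cases hd : Direct w
    · by_cases hd' : Direct (w.map Action.bar)
      · rcases eq_nil_or_append_singleton w with rfl | ⟨v, κ, rfl⟩
        · exact h.visited_close_nil
        -- With both polarities direct, every action is justified by its predecessor: the play is
        -- the justifier sequence of its last action.
        · have hchain : (v ++ [κ]).IsChain Justifies := by
            rw [List.isChain_iff_forall_rel_of_append_cons_cons]
            intro a b l₁ l₂ e
            by_cases hb : b.polarity = .minus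
            · rcases hd (l₁ ++ [a]) b l₂ (by simpa using e) hb with h₀ | ⟨l', x, e₁, hx⟩
              · simp at h₀
              · obtain ⟨-, e₂⟩ := List.append_inj' e₁ rfl
                simp only [List.cons.injEq, and_true] at e₂
                rwa [e₂]
            · have hbd : b ≠ .daimon := by
                rintro rfl
                exact hw.proper (by rw [e]; simp)
              rcases hd' ((l₁ ++ [a]).map Action.bar) b.bar (l₂.map Action.bar)
                (by rw [e]; simp) (by rw [Action.bar_polarity hbd]; simpa using hb) with
                h₀ | ⟨l', x, e₁, hx⟩
              · simp at h₀
              · rw [List.map_append, List.map_singleton] at e₁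
                obtain ⟨-, e₂⟩ := List.append_inj' e₁ rfl
                simp only [List.cons.injEq, and_true] at e₂
                rw [← justifies_bar, e₂]
                exact hx
          obtain ⟨t, htj, htriv⟩ := ht κ (by simp)
          have hself : IsJustifierSequence β (v ++ [κ]) κ (v ++ [κ]) := by
            refine ⟨List.Sublist.refl _, by simp, hchain, ?_⟩
            obtain ⟨a, u, e⟩ := List.exists_cons_of_ne_nil (by simp : v ++ [κ] ≠ [])
            refine ⟨a, by rw [e]; rfl, ?_⟩
            have := hw.justified [] a u e (by
              rintro rfl
              exact hw.proper (by rw [e]; simp))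
            simpa using this
          rw [htj.unique hw.linear hself] at htriv
          exact h.visited_trivialChronicle hA hB htriv
      -- The fault lies with a positive action; it becomes negative in the reversed play, which is
      -- shuffled in `B`.
      · obtain ⟨w₁, w₂, h₁, h₂, s₁, s₂, l₁, l₂, hs⟩ := hw.map_bar.exists_shuffle hd'
        have key : ∀ {w'}, Play β.dual w' → w' <+ w.map Action.bar →
            w'.length < (w.map Action.bar).length → Visited B A (close β.dual w') := by
          intro w' hp hsub hlen
          have hv := (ih' (w' := w'.map Action.bar) (by simpa using hp.map_bar)
            (by simpa using hsub.map Action.bar) (by simpa using hlen)).symm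
          rwa [dual_close (by simpa using hp.proper), map_bar_map_bar] at hv
        have hv := (hsB _ _ _ (key h₁ s₁ l₁) (key h₂ s₂ l₂) hs hw.map_bar.reversible).symm
        rwa [dual_close hw.map_bar.proper, map_bar_map_bar, Base.dual_dual] at hv
    · obtain ⟨w₁, w₂, h₁, h₂, s₁, s₂, l₁, l₂, hs⟩ := hw.exists_shuffle hd
      exact hsA _ _ _ (ih' h₁ s₁ l₁) (ih' h₂ s₂ l₂) hs hw.reversible

theorem visited_of_regularPath (h : DualPair β A B)
    (hA : ∀ D, Material A D → ∀ c ∈ D, PositiveEnded c → Visited A B c)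
    (hB : ∀ E, Material B E → ∀ c ∈ E, PositiveEnded c → Visited B A c)
    (hsA : ∀ p q r, Visited A B p → Visited A B q → Shuffle p q r → Reversible β r →
      Visited A B r)
    (hsB : ∀ p q r, Visited B A p → Visited B A q → Shuffle p q r → Reversible β.dual r →
      Visited B A r)
    {p : List Action} (hp : RegularPath β A p) : Visited A B p := by
  rw [hp.1.eq_close]
  refine h.visited_of_play hA hB hsA hsB hp.1.play_core fun κ hκ => ?_
  obtain ⟨hκ, hne⟩ := mem_core.1 hκ
  obtain ⟨t, ht, htriv⟩ := hp.2 κ hκ hne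
  exact ⟨t, isJustifierSequence_core.2 ht, htriv⟩

end DualPair

end Ludics

theorem mainTheorem6 (β : Ludics.Base) (A : Set (Set (List Ludics.Action)))
    (hA : Ludics.IsBehaviour β A) :
    Ludics.Regular β A ↔ Ludics.ShuffleRegular β A := by
  have h := hA.dualPair
  -- Bi-orthogonality identifies the designs tested against `orth β A` with those of `A`.
  have hv : ∀ p, Ludics.Visitable β.dual (Ludics.orth β A) p ↔
      Ludics.Visited (Ludics.orth β A) A p := fun p => by
    rw [Ludics.Visitable, ← hA.2]
    exact Iff.rfl
  constructor
  · intro hreg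
    refine ⟨fun D hD c hc hp => h.visited_chronicle hreg hD hc hp,
      fun E hE c hc hp => (hv c).2 (h.visited_chronicle_right hreg hE hc hp),
      fun p q r hp hq hs hr => h.visited_shuffle hreg hp hq hs hr,
      fun p q r hp hq hs hr => (hv r).2
        (h.visited_shuffle_right hreg ((hv p).1 hp) ((hv q).1 hq) hs hr)⟩
  · rintro ⟨h₁, h₂, h₃, h₄⟩ p hp
    exact h.visited_of_regularPath h₁ (fun E hE c hc hp => (hv c).1 (h₂ E hE c hc hp)) h₃
      (fun p q r hp hq hs hr => (hv r).1 (h₄ p q r ((hv p).2 hp) ((hv q).2 hq) hs hr)) hp
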